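/- Let $n\ge 0$ be an integer (for $n\ge1$ this is the usual setting), let $\alpha,\beta>0$, and let $u_0,v_0\in L^2(\mathbb R^n)$ be complex-valued. Write $\widehat f(\xi)=(2\pi)^{-n/2}\int_{\mathbb R^n}e^{-ix\cdot\xi}f(x)\,dx$ for the Fourier transform (extended to $L^2(\mathbb R^n)$ by Plancherel), and let $e^{it\Delta}f=\big(e^{-it|\xi|^2}\widehat f\,\big)^{\vee}$ be the solution at time $t$ of the free Schrödinger equation $\partial_tu=i\Delta u$, $u(0)=f$. For $T>0$ put $$\theta(t)=\frac{\beta(T-t)}{T(\alpha t+\beta)},\qquad \mu(t)=\frac{\beta}{\alpha t+\beta}.$$ All norms below are $L^2(\mathbb R^{2n})$ norms, in the variables $(x,y)$ or $(\xi,\eta)$, with values in $[0,\infty]$. Each inequality asserts that if its right-hand side is finite, then so is its left-hand side, and the inequality holds. (A zeroth power is $1$, and $0\cdot\infty=0$.) For all $\lambda\in\mathbb R^n$, $T>0$ and $0\le t\le T$, $$\Big\|e^{\frac{\lambda\cdot(x-y)}{\alpha t+\beta}}e^{it\Delta}u_0(x)\,e^{it\Delta}v_0(y)\Big\|\le\Big\|e^{\frac{\lambda\cdot(x-y)}{\beta}}u_0(x)\,v_0(y)\Big\|^{\theta(t)}\,\Big\|e^{\frac{\lambda\cdot(x-y)}{\alpha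 T+\beta}}e^{iT\Delta}u_0(x)\,e^{iT\Delta}v_0(y)\Big\|^{1-\theta(t)},$$ $$\Big\|e^{\frac{|x-y|^2}{(\alpha t+\beta)^2}}e^{it\Delta}u_0(x)\,e^{it\Delta}v_0(y)\Big\|\le\Big\|e^{\frac{|x-y|^2}{\beta^2}}u_0(x)\,v_0(y)\Big\|^{\theta(t)}\,\Big\|e^{\frac{|x-y|^2}{(\alpha T+\beta)^2}}e^{iT\Delta}u_0(x)\,e^{iT\Delta}v_0(y)\Big\|^{1-\theta(t)}.$$ For all $\lambda\in\mathbb R^n$ and $t\ge0$, $$\Big\|e^{\frac{\lambda\cdot(x-y)}{\alpha t+\beta}}e^{it\Delta}u_0(x)\,e^{it\Delta}v_0(y)\Big\|\le\Big\|e^{\frac{\lambda\cdot(x-y)}{\beta}}u_0(x)\,v_0(y)\Big\|^{\mu(t)}\,\Big\|e^{\frac{2\lambda\cdot(\xi-\eta)}{\alpha}}\widehat{u_0}(\xi)\,\widehat{v_0}(\eta)\Big\|^{1-\mu(t)},$$ $$\Big\|e^{\frac{|x-y|^2}{(\alpha t+\beta)^2}}e^{it\Delta}u_0(x)\,e^{it\Delta}v_0(y)\Big\|\le\Big\|e^{\frac{|x-y|^2}{\beta^2}}u_0(x)\,v_0(y)\Big\|^{\mu(t)}\,\Big\|e^{\frac{4|\xi-\eta|^2}{\alpha^2}}\widehat{u_0}(\xi)\,\widehat{v_0}(\eta)\Big\|^{1-\mu(t)}.$$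 -/

import Mathlib

open MeasureTheory FourierTransform
open scoped ENNReal

noncomputable section

/-- The Euclidean space `ℝⁿ`. -/
abbrev Rn (n : ℕ) : Type := EuclideanSpace ℝ (Fin n)

/-- The Hilbert space `L²(ℝⁿ; ℂ)`. -/
abbrev L2Rn (n : ℕ) : Type := Lp ℂ 2 (volume : Measure (Rn n))

/-- The Fourier symbol of `e^{itΔ}` with respect to the Fourier transform with kernel
`e^{-2πi x·ζ}`: since `Δ` has the symbol `-|2πζ|²` there, it is `e^{-it|2πζ|²}`. -/
def schrodingerSymbol {n : ℕ} (t : ℝ) (ζ : Rn n) : ℂ :=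
  Complex.exp (-(Complex.I * (t : ℂ) * (((2 * Real.pi * ‖ζ‖) ^ 2 : ℝ) : ℂ)))

theorem continuous_schrodingerSymbol {n : ℕ} (t : ℝ) :
    Continuous (schrodingerSymbol t : Rn n → ℂ) := by
  unfold schrodingerSymbol
  fun_prop

theorem norm_schrodingerSymbol {n : ℕ} (t : ℝ) (ζ : Rn n) : ‖schrodingerSymbol t ζ‖ = 1 := by
  rw [schrodingerSymbol, Complex.norm_exp]
  simp [-Complex.ofReal_pow]

theorem memLp_schrodingerSymbol_mul {n : ℕ} (t : ℝ) (f : L2Rn n) :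
    MemLp (fun ζ : Rn n => schrodingerSymbol t ζ * f ζ) 2 volume := by
  refine (Lp.memLp f).of_le
    ((continuous_schrodingerSymbol t).aestronglyMeasurable.mul (Lp.aestronglyMeasurable f)) ?_
  refine Filter.Eventually.of_forall fun ζ => ?_
  simp [norm_schrodingerSymbol]

/-- The free Schrödinger evolution `e^{itΔ}u₀` of `u₀ ∈ L²(ℝⁿ)`, that is, the solution at time `t`
of `∂ₜu = iΔu`, `u(0) = u₀`: the Fourier multiplier with symbol `e^{-it|2πζ|²}`, where `𝓕` is the
(Plancherel) Fourier transform of `L²(ℝⁿ)`. -/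
def freeSchrodinger {n : ℕ} (t : ℝ) (u₀ : L2Rn n) : L2Rn n :=
  𝓕⁻ ((memLp_schrodingerSymbol_mul t (𝓕 u₀)).toLp
    (fun ζ : Rn n => schrodingerSymbol t ζ * (𝓕 u₀ : L2Rn n) ζ))

/-- The Fourier transform of `u ∈ L²(ℝⁿ)` in the normalization
`û(ξ) = (2π)^{-n/2} ∫ e^{-ix·ξ} u(x) dx`, which is `(2π)^{-n/2} (𝓕 u)(ξ / (2π))` for the
transform `𝓕` with kernel `e^{-2πi x·ζ}`. -/
def unitaryFourier {n : ℕ} (u : L2Rn n) (ξ : Rn n) : ℂ :=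
  (((2 * Real.pi) ^ (-((n : ℝ) / 2)) : ℝ) : ℂ) * (𝓕 u : L2Rn n) ((2 * Real.pi)⁻¹ • ξ)

/-- The weighted norm `‖e^{w(x-y)} f(x) g(y)‖` in `L²(ℝ²ⁿ)`, an element of `[0,∞]`. -/
def interactionNorm {n : ℕ} (w : Rn n → ℝ) (f g : Rn n → ℂ) : ℝ≥0∞ :=
  eLpNorm (fun p : Rn n × Rn n => (Real.exp (w (p.1 - p.2)) : ℂ) * (f p.1 * g p.2)) 2
    ((volume : Measure (Rn n)).prod volume)

/-- The exponent `θ(t) = β(T - t) / (T(αt + β))`. -/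
def thetaExp (α β T t : ℝ) : ℝ := β * (T - t) / (T * (α * t + β))

/-- The exponent `μ(t) = β / (αt + β)`. -/
def muExp (α β t : ℝ) : ℝ := β / (α * t + β)

end

/-!
The norm `‖e^{a·x} f‖` is a norm of `𝓕 f` under a complex translation, so both it and the norms
`‖e^{b·ζ} 𝓕 f‖` belong to the family of norms `‖exp(b·ζ + i c·∇) 𝓕 f‖` of complex Heisenberg–Weyl
operators, indexed by the points `(c, b)` of phase space. These unbounded operators are handled by
duality with sums of complex Gaussians, on which they act. Along a complexified line of phase space
the dual pairing is entire, and imaginary displacements act unitarily up to the exponential factor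
of the commutation relation, so Hadamard's three lines theorem makes the norm log-convex along every
segment. The free evolution multiplies `𝓕 f` by a chirp, which only shears phase space; hence
`‖e^{a·x} e^{itΔ}f‖` is, up to constants, the norm of `𝓕 f` at the point `(a, 2ta)`, and the
one-particle inequalities express that one such point lies on the segment joining two others, or
joining another one to a point `(0, b)`.

A linear weight in `x - y` factorizes over the two particles. A quadratic one is a Gaussian average
of linear ones, `e^{2|z|²/c²} = 𝔼 e^{2 l·z/c}` for a standard Gaussian vector `l`, and Hölder's
inequality in `l` transfers the estimate.
-/

open scoped InnerProductSpace

section Pairing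

variable {X : Type*} [MeasurableSpace X] {μ : Measure X}

theorem inner_star_left_eq_integral (f g : Lp ℂ 2 μ) : ⟪star f, g⟫_ℂ = ∫ x, f x * g x ∂μ := by
  rw [L2.inner_def]
  refine integral_congr_ae ?_
  filter_upwards [Lp.coeFn_star f] with x hx
  simp [hx, mul_comm]

theorem inner_star_left_comm (f g : Lp ℂ 2 μ) : ⟪star f, g⟫_ℂ = ⟪star g, f⟫_ℂ := by
  simp only [inner_star_left_eq_integral, mul_comm]

theorem norm_inner_star_left_le (f g : Lp ℂ 2 μ) : ‖⟪star f, g⟫_ℂ‖ ≤ ‖f‖ * ‖g‖ := by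
  have h : ‖star f‖ = ‖f‖ := by
    rw [Lp.norm_def, Lp.norm_def]
    congr 1
    refine eLpNorm_congr_norm_ae ?_
    filter_upwards [Lp.coeFn_star f] with x hx
    simp [hx]
  exact h ▸ norm_inner_le_norm _ _

end Pairing

section Fourier

open SchwartzMap

theorem continuous_neg_innerₗ {V : Type*} [NormedAddCommGroup V] [InnerProductSpace ℝ V] :
    Continuous fun p : V × V => (-innerₗ V) p.1 p.2 :=
  continuous_inner.neg

variable {V : Type*} [NormedAddCommGroup V] [InnerProductSpace ℝ V] [FiniteDimensional ℝ V]
  [MeasurableSpace V] [BorelSpace V]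

theorem integral_fourierInv_mul_eq {f g : V → ℂ} (hf : Integrable f) (hg : Integrable g) :
    ∫ x, 𝓕⁻ f x * g x = ∫ x, f x * 𝓕⁻ g x := by
  have hflip : (-innerₗ V).flip = -innerₗ V := by ext x y; simp [real_inner_comm]
  simpa only [hflip, smul_eq_mul] using!
    VectorFourier.integral_fourierIntegral_smul_eq_flip (μ := (volume : Measure V))
      (ν := (volume : Measure V)) (L := -innerₗ V) Real.continuous_fourierChar
      continuous_neg_innerₗ hf hg

theorem ae_eq_of_forall_integral_schwartz_mul_eq {f g : V → ℂ} (hf : LocallyIntegrable f)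
    (hg : LocallyIntegrable g) (h : ∀ φ : 𝓢(V, ℂ), ∫ x, φ x * f x = ∫ x, φ x * g x) :
    f =ᵐ[volume] g := by
  refine ae_eq_of_integral_contDiff_smul_eq hf hg fun φ hφ hφc => ?_
  have hφc' : HasCompactSupport (Complex.ofRealCLM ∘ φ) := hφc.comp_left rfl
  have hφ' : ContDiff ℝ ((⊤ : ℕ∞) : WithTop ℕ∞) (Complex.ofRealCLM ∘ φ) := by fun_prop
  simpa using! h (hφc'.toSchwartzMap hφ')

theorem ae_eq_zero_of_fourierInv_eq_zero {f : V → ℂ} (hf : Integrable f) (h : 𝓕⁻ f = 0) :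
    f =ᵐ[volume] 0 := by
  refine ae_eq_of_forall_integral_schwartz_mul_eq hf.locallyIntegrable
    (locallyIntegrable_const 0) fun φ => ?_
  have hφ : (φ : V → ℂ) = 𝓕⁻ ((𝓕 φ : 𝓢(V, ℂ)) : V → ℂ) := by
    rw [← fourierInv_coe, fourierInv_fourier_eq]
  rw [hφ, integral_fourierInv_mul_eq (𝓕 φ).integrable hf, h]
  simp

theorem integral_schwartz_mul_fourierInv (φ : 𝓢(V, ℂ)) (f : Lp ℂ 2 (volume : Measure V)) :
    ∫ x, φ x * (𝓕⁻ f : Lp ℂ 2 (volume : Measure V)) x = ∫ x, 𝓕⁻ (φ : V → ℂ) x * f x := by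
  have h := DFunLike.congr_fun (Lp.fourierInv_toTemperedDistribution_eq f) φ
  rw [TemperedDistribution.fourierInv_apply, Lp.toTemperedDistribution_apply,
    Lp.toTemperedDistribution_apply] at h
  simpa only [smul_eq_mul, fourierInv_coe] using! h.symm

theorem fourierInv_toLp_ae_eq {f : V → ℂ} (hf : Integrable f) (hf' : MemLp f 2 volume) :
    (𝓕⁻ (hf'.toLp f) : Lp ℂ 2 (volume : Measure V)) =ᵐ[volume] 𝓕⁻ f := by
  have hFinv : Continuous (𝓕⁻ f) := VectorFourier.fourierIntegral_continuous
    Real.continuous_fourierChar continuous_neg_innerₗ hf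
  refine ae_eq_of_forall_integral_schwartz_mul_eq ((Lp.memLp _).locallyIntegrable one_le_two)
    hFinv.locallyIntegrable fun φ => ?_
  rw [integral_schwartz_mul_fourierInv, ← integral_fourierInv_mul_eq φ.integrable hf]
  refine integral_congr_ae ?_
  filter_upwards [hf'.coeFn_toLp] with x hx
  rw [hx]

theorem inner_star_fourierInv_left (f g : Lp ℂ 2 (volume : Measure V)) :
    ⟪star (𝓕⁻ f), g⟫_ℂ = ⟪star f, 𝓕⁻ g⟫_ℂ := by
  refine DenseRange.induction_on
    (p := fun f : Lp ℂ 2 (volume : Measure V) => ⟪star (𝓕⁻ f), g⟫_ℂ = ⟪star f, 𝓕⁻ g⟫_ℂ)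
    (denseRange_toLpCLM (p := 2) ENNReal.ofNat_ne_top) f ?_ fun φ => ?_
  · simp only [inner_star_left_comm _ g, inner_star_left_comm _ (𝓕⁻ g)]
    exact isClosed_eq (continuous_const.inner ContinuousFourierInv.continuous_fourierInv)
      (continuous_const.inner continuous_id)
  rw [toLpCLM_apply, toLp_fourierInv_eq, inner_star_left_eq_integral, inner_star_left_eq_integral]
  convert (integral_schwartz_mul_fourierInv φ g).symm using 1 <;> refine integral_congr_ae ?_
  · filter_upwards [(𝓕⁻ φ).coeFn_toLp 2 volume] with x hx
    rw [hx, fourierInv_coe]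
  · filter_upwards [φ.coeFn_toLp 2 volume] with x hx
    rw [hx]

end Fourier

theorem exists_eq_inner_of_forall_norm_le {E H : Type*} [AddCommGroup E] [Module ℂ E]
    [NormedAddCommGroup H] [InnerProductSpace ℂ H] [CompleteSpace H] (ι : E →ₗ[ℂ] H)
    (ℓ : E →ₗ[ℂ] ℂ) {N : ℝ} (hN : 0 ≤ N) (h : ∀ x, ‖ℓ x‖ ≤ N * ‖ι x‖) :
    ∃ ψ : H, ‖ψ‖ ≤ N ∧ ∀ x, ℓ x = ⟪ψ, ι x⟫_ℂ := by
  obtain ⟨g, hg, hgn⟩ := exists_extension_norm_eq _ (ℓ.compLeftInverse ι)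
  refine ⟨(InnerProductSpace.toDual ℂ H).symm g, ?_, fun x => ?_⟩
  · rw [LinearIsometryEquiv.norm_map, hgn]
    refine ContinuousLinearMap.opNorm_le_bound _ hN ?_
    rintro ⟨_, x, rfl⟩
    rw [LinearMap.compLeftInverse_apply_of_bdd _ _ ⟨N, h⟩ x _ rfl]
    exact h x
  · rw [InnerProductSpace.toDual_symm_apply,
      ← LinearMap.compLeftInverse_apply_of_bdd ℓ ι ⟨N, h⟩ x _ rfl]
    exact (hg ⟨ι x, x, rfl⟩).symm

theorem aestronglyMeasurable_deriv_of_forall {X E : Type*} [MeasurableSpace X] {μ : Measure X}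
    [NormedAddCommGroup E] [NormedSpace ℂ E] {f : ℂ → X → E}
    (hf : ∀ᵐ x ∂μ, Differentiable ℂ fun z => f z x) (hm : ∀ z, AEStronglyMeasurable (f z) μ)
    (z : ℂ) : AEStronglyMeasurable (fun x => deriv (fun w => f w x) z) μ := by
  obtain ⟨u, hu⟩ := (nhdsWithin (0 : ℂ) {0}ᶜ).exists_seq_tendsto
  refine aestronglyMeasurable_of_tendsto_ae Filter.atTop
    (f := fun k x => (u k)⁻¹ • (f (z + u k) x - f z x))
    (fun k => ((hm _).sub (hm _)).const_smul _) ?_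
  filter_upwards [hf] with x hx
  exact (hasDerivAt_iff_tendsto_slope_zero.1 (hx z).hasDerivAt).comp hu

theorem differentiable_integral_of_dominated {X E : Type*} [MeasurableSpace X] {μ : Measure X}
    [NormedAddCommGroup E] [NormedSpace ℂ E] {f : ℂ → X → E}
    (hf : ∀ᵐ x ∂μ, Differentiable ℂ fun z => f z x) (hm : ∀ z, AEStronglyMeasurable (f z) μ)
    (hb : ∀ R : ℝ, ∃ g : X → ℝ, Integrable g μ ∧
      ∀ᵐ x ∂μ, ∀ z ∈ Metric.closedBall (0 : ℂ) R, ‖f z x‖ ≤ g x) :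
    Differentiable ℂ fun z => ∫ x, f z x ∂μ := by
  intro z₀
  obtain ⟨g, hg, hfg⟩ := hb (‖z₀‖ + 2)
  have hderiv : ∀ᵐ x ∂μ, ∀ z ∈ Metric.ball z₀ 1, ‖deriv (fun w => f w x) z‖ ≤ g x := by
    filter_upwards [hf, hfg] with x hx hgx z hz
    simpa using Complex.norm_deriv_le_of_forall_mem_sphere_norm_le one_pos hx.diffContOnCl
      fun w hw => hgx w (by
        rw [mem_closedBall_zero_iff]
        rw [mem_sphere_iff_norm] at hw
        rw [mem_ball_iff_norm] at hz
        linarith [norm_le_norm_add_norm_sub' w z, norm_le_norm_add_norm_sub' z z₀])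
  have hint : Integrable (f z₀) μ := by
    refine hg.mono' (hm z₀) ?_
    filter_upwards [hfg] with x hx
    exact hx z₀ (by simp)
  refine (hasDerivAt_integral_of_dominated_loc_of_deriv_le (Metric.ball_mem_nhds z₀ one_pos)
    (Filter.Eventually.of_forall hm) hint (aestronglyMeasurable_deriv_of_forall hf hm z₀)
    hderiv hg ?_).2.differentiableAt
  filter_upwards [hf] with x hx z _
  exact (hx z).hasDerivAt

open Complex.HadamardThreeLines in
theorem norm_le_interp_of_exponential_growth {f : ℂ → ℂ} (hf : Differentiable ℂ f)
    {C k : ℝ} (hgrowth : ∀ z : ℂ, z.re ∈ Set.Icc 0 1 → ‖f z‖ ≤ C * Real.exp (k * |z.im|))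
    {a b : ℝ} (ha : ∀ z : ℂ, z.re = 0 → ‖f z‖ ≤ a) (hb : ∀ z : ℂ, z.re = 1 → ‖f z‖ ≤ b)
    {z : ℂ} (hz : z.re ∈ Set.Icc 0 1) : ‖f z‖ ≤ a ^ (1 - z.re) * b ^ z.re := by
  have hbdd : BddAbove ((norm ∘ f) '' verticalClosedStrip 0 1) := by
    refine ⟨max a b, ?_⟩
    rintro _ ⟨w, hw, rfl⟩
    refine PhragmenLindelof.vertical_strip hf.diffContOnCl ⟨1, ?_, |k|, ?_⟩
      (fun w hw => (ha w hw).trans (le_max_left _ _))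
      (fun w hw => (hb w hw).trans (le_max_right _ _)) hw.1 hw.2
    · rw [sub_zero, div_one]
      linarith [Real.pi_gt_three]
    · refine Asymptotics.IsBigO.of_bound |C| (Filter.eventually_inf_principal.2
        (Filter.Eventually.of_forall fun w hw => ?_))
      rw [Real.norm_of_nonneg (Real.exp_pos _).le, one_mul]
      refine (hgrowth w (Set.Ioo_subset_Icc_self hw)).trans ?_
      gcongr
      · exact le_abs_self C
      · exact le_abs_self k
      · linarith [Real.add_one_le_exp |w.im|]
  exact norm_le_interp_of_mem_verticalClosedStrip₀₁' f hz hf.diffContOnCl hbdd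
    (fun w hw => ha w hw) (fun w hw => hb w hw)

open Matrix

/-- The complex Gaussian `exp(-q Z·Z + w·Z)` on `ℂⁿ`, where `·` is the bilinear (not sesquilinear)
dot product, so that it is holomorphic in `w` and `Z`. -/
noncomputable def cgauss {n : ℕ} (q : ℂ) (w Z : Fin n → ℂ) : ℂ :=
  Complex.exp (-q * (Z ⬝ᵥ Z) + w ⬝ᵥ Z)

/-- The linear combinations of complex Gaussians that decay on `ℝⁿ`: entire functions serving as
test functions that are stable under complex translations, modulations and Fourier transforms. -/
def GaussianSum (n : ℕ) : Submodule ℂ ((Fin n → ℂ) → ℂ) :=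
  Submodule.span ℂ {G | ∃ q w, 0 < q.re ∧ G = cgauss q w}

/-- A vector of `ℝⁿ`, regarded as a vector of `ℂⁿ`. -/
def toC {n : ℕ} (x : Rn n) : Fin n → ℂ := fun i => (x i : ℂ)

section GaussianSums

variable {n : ℕ}

theorem toC_dotProduct (x y : Rn n) : toC x ⬝ᵥ toC y = (⟪x, y⟫_ℝ : ℂ) := by
  simp [toC, dotProduct, PiLp.inner_apply, mul_comm]

theorem toC_dotProduct_self (x : Rn n) : toC x ⬝ᵥ toC x = (‖x‖ ^ 2 : ℝ) := by
  rw [toC_dotProduct, real_inner_self_eq_norm_sq]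

theorem toC_zero : toC (0 : Rn n) = 0 := by
  ext; simp [toC]

theorem toC_add (x y : Rn n) : toC (x + y) = toC x + toC y := by
  ext i; simp [toC]

theorem toC_smul (c : ℝ) (x : Rn n) : toC (c • x) = (c : ℂ) • toC x := by
  ext i; simp [toC]

theorem continuous_toC : Continuous (toC : Rn n → Fin n → ℂ) := by
  unfold toC; fun_prop

theorem norm_toC_le (x : Rn n) : ‖toC x‖ ≤ ‖x‖ :=
  (pi_norm_le_iff_of_nonneg (norm_nonneg _)).2 fun i => by
    simpa [toC] using PiLp.norm_apply_le x i

theorem norm_dotProduct_le (x y : Fin n → ℂ) : ‖x ⬝ᵥ y‖ ≤ n * ‖x‖ * ‖y‖ := by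
  calc ‖x ⬝ᵥ y‖ ≤ ∑ i, ‖x i * y i‖ := norm_sum_le _ _
    _ ≤ ∑ _i : Fin n, ‖x‖ * ‖y‖ := by
        refine Finset.sum_le_sum fun i _ => ?_
        rw [norm_mul]
        gcongr <;> exact norm_le_pi_norm _ i
    _ = n * ‖x‖ * ‖y‖ := by simp [mul_assoc]

theorem continuous_dotProduct : Continuous fun p : (Fin n → ℂ) × (Fin n → ℂ) => p.1 ⬝ᵥ p.2 := by
  unfold dotProduct; fun_prop

theorem cgauss_mem {q : ℂ} (hq : 0 < q.re) (w : Fin n → ℂ) : cgauss q w ∈ GaussianSum n :=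
  Submodule.subset_span ⟨q, w, hq, rfl⟩

@[elab_as_elim]
theorem GaussianSum.induction {p : GaussianSum n → Prop}
    (cgauss : ∀ q w (hq : 0 < q.re), p ⟨cgauss q w, cgauss_mem hq w⟩) (zero : p 0)
    (add : ∀ G H, p G → p H → p (G + H)) (smul : ∀ (c : ℂ) G, p G → p (c • G)) (G : GaussianSum n) :
    p G := by
  obtain ⟨G, hG⟩ := G
  induction hG using Submodule.span_induction with
  | mem G h =>
    obtain ⟨q, w, hq, rfl⟩ := h
    exact cgauss q w hq
  | zero => exact zero
  | add G H _ _ hG hH => exact add _ _ hG hH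
  | smul c G _ hG => exact smul c _ hG

theorem GaussianSum.differentiable (G : GaussianSum n) :
    Differentiable ℂ (G : (Fin n → ℂ) → ℂ) := by
  induction G using GaussianSum.induction with
  | cgauss q w hq =>
    change Differentiable ℂ fun Z => Complex.exp (-q * (Z ⬝ᵥ Z) + w ⬝ᵥ Z)
    unfold dotProduct
    fun_prop
  | zero => exact differentiable_const 0
  | add G H hG hH => exact hG.add hH
  | smul c G hG => exact hG.const_smul c

theorem norm_cgauss_toC_le {q : ℂ} (hq : 0 < q.re) (w : Fin n → ℂ) (x : Rn n) :
    ‖cgauss q w (toC x)‖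
      ≤ Real.exp ((n * ‖w‖) ^ 2 / (2 * q.re)) * Real.exp (-(q.re / 2) * ‖x‖ ^ 2) := by
  have hw : (w ⬝ᵥ toC x).re ≤ n * ‖w‖ * ‖x‖ :=
    (Complex.re_le_norm _).trans ((norm_dotProduct_le _ _).trans (by gcongr; exact norm_toC_le x))
  have amgm : n * ‖w‖ * ‖x‖ ≤ (n * ‖w‖) ^ 2 / (2 * q.re) + q.re / 2 * ‖x‖ ^ 2 := by
    have h : 0 ≤ (n * ‖w‖ - q.re * ‖x‖) ^ 2 / (2 * q.re) := by positivity
    have e : (n * ‖w‖ - q.re * ‖x‖) ^ 2 / (2 * q.re)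
        = (n * ‖w‖) ^ 2 / (2 * q.re) + q.re / 2 * ‖x‖ ^ 2 - n * ‖w‖ * ‖x‖ := by
      field_simp; ring
    linarith
  rw [cgauss, Complex.norm_exp, ← Real.exp_add, Real.exp_le_exp, Complex.add_re,
    toC_dotProduct_self, Complex.re_mul_ofReal, Complex.neg_re]
  linarith

theorem integrable_exp_neg_mul_norm_sq {r : ℝ} (hr : 0 < r) :
    Integrable fun x : Rn n => Real.exp (-r * ‖x‖ ^ 2) := by
  refine (GaussianFourier.integrable_cexp_neg_mul_sq_norm_add (V := Rn n) (b := (r : ℂ))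
    (by simpa using hr) 0 0).norm.congr (Filter.Eventually.of_forall fun x => ?_)
  simp [Complex.norm_exp, ← Complex.ofReal_pow]

theorem memLp_exp_neg_mul_norm_sq {r : ℝ} (hr : 0 < r) :
    MemLp (fun x : Rn n => Real.exp (-r * ‖x‖ ^ 2)) 2 volume := by
  refine (memLp_two_iff_integrable_sq (by fun_prop)).2
    ((integrable_exp_neg_mul_norm_sq (n := n) (r := 2 * r) (by positivity)).congr
      (Filter.Eventually.of_forall fun x => ?_))
  simp only [← Real.exp_nat_mul]
  congr 1
  push_cast
  ring

theorem integral_cgauss {q : ℂ} (hq : 0 < q.re) (w : Fin n → ℂ) :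
    ∫ x : Rn n, cgauss q w (toC x)
      = (Real.pi / q) ^ (n / 2 : ℂ) * Complex.exp ((w ⬝ᵥ w) / (4 * q)) := by
  rw [← (PiLp.volume_preserving_toLp (Fin n)).integral_comp
    (MeasurableEquiv.toLp 2 _).measurableEmbedding]
  simpa only [Fintype.card_fin, pow_two] using! GaussianFourier.integral_cexp_neg_mul_sum_add hq w

end GaussianSums

section Operators

variable {n : ℕ}

theorem GaussianSum.map_mem {T : ((Fin n → ℂ) → ℂ) →ₗ[ℂ] ((Fin n → ℂ) → ℂ)}
    (hT : ∀ q w, 0 < q.re → T (cgauss q w) ∈ GaussianSum n) {G : (Fin n → ℂ) → ℂ}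
    (hG : G ∈ GaussianSum n) : T G ∈ GaussianSum n := by
  have h : GaussianSum n ≤ (GaussianSum n).comap T := Submodule.span_le.2 <| by
    rintro _ ⟨q, w, hq, rfl⟩
    exact hT q w hq
  exact h hG

theorem exp_mul_cgauss_add (q : ℂ) (w A B Z : Fin n → ℂ) :
    Complex.exp (B ⬝ᵥ Z + A ⬝ᵥ B / 2) * cgauss q w (Z + A)
      = Complex.exp (-q * (A ⬝ᵥ A) + w ⬝ᵥ A + A ⬝ᵥ B / 2) *
        cgauss q (w + B - (2 * q) • A) Z := by
  simp only [cgauss, ← Complex.exp_add]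
  congr 1
  simp only [add_dotProduct, dotProduct_add, sub_dotProduct, smul_dotProduct, smul_eq_mul,
    dotProduct_comm Z A]
  ring

theorem exp_mul_cgauss_of_sq (q s : ℂ) (w Z : Fin n → ℂ) :
    Complex.exp (s * (Z ⬝ᵥ Z)) * cgauss q w Z = cgauss (q - s) w Z := by
  simp only [cgauss, ← Complex.exp_add]
  congr 1
  ring

/-- The complex Heisenberg–Weyl operator `(weyl A B G)(Z) = exp(B·Z + A·B/2) G(Z + A)`. The factor
`exp(A·B/2)` is the symmetric normalization: formally `weyl A B = exp(B·Z + A·∂)`. -/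
noncomputable def weyl (A B : Fin n → ℂ) : GaussianSum n →ₗ[ℂ] GaussianSum n :=
  LinearMap.restrict
    (LinearMap.mulLeft ℂ (fun Z => Complex.exp (B ⬝ᵥ Z + A ⬝ᵥ B / 2)) ∘ₗ
      LinearMap.funLeft ℂ ℂ (fun Z => Z + A))
    fun _ hG => GaussianSum.map_mem (fun q w hq => by
      convert (GaussianSum n).smul_mem (Complex.exp (-q * (A ⬝ᵥ A) + w ⬝ᵥ A + A ⬝ᵥ B / 2))
        (cgauss_mem hq (w + B - (2 * q) • A)) using 1
      exact funext fun Z => exp_mul_cgauss_add q w A B Z) hG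

/-- Multiplication by the chirp `exp(is Z·Z)`, which is the free evolution on the Fourier side. -/
noncomputable def chirp (s : ℝ) : GaussianSum n →ₗ[ℂ] GaussianSum n :=
  LinearMap.restrict
    (LinearMap.mulLeft ℂ (fun Z => Complex.exp (Complex.I * s * (Z ⬝ᵥ Z))))
    fun _ hG => GaussianSum.map_mem (fun q w hq => by
      convert cgauss_mem (q := q - Complex.I * s) (by simpa using hq) w using 1
      exact funext fun Z => exp_mul_cgauss_of_sq q _ w Z) hG

theorem weyl_apply (A B : Fin n → ℂ) (G : GaussianSum n) (Z : Fin n → ℂ) :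
    (weyl A B G).1 Z = Complex.exp (B ⬝ᵥ Z + A ⬝ᵥ B / 2) * G.1 (Z + A) := rfl

theorem chirp_apply (s : ℝ) (G : GaussianSum n) (Z : Fin n → ℂ) :
    (chirp s G).1 Z = Complex.exp (Complex.I * s * (Z ⬝ᵥ Z)) * G.1 Z := rfl

theorem weyl_zero_zero (G : GaussianSum n) : weyl 0 0 G = G := by
  ext Z; simp [weyl_apply]

theorem weyl_weyl (A B A' B' : Fin n → ℂ) (G : GaussianSum n) :
    weyl A B (weyl A' B' G)
      = Complex.exp ((A ⬝ᵥ B' - A' ⬝ᵥ B) / 2) • weyl (A + A') (B + B') G := by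
  ext Z
  simp only [weyl_apply, Submodule.coe_smul, Pi.smul_apply, smul_eq_mul, ← mul_assoc,
    ← Complex.exp_add, add_assoc]
  congr 2
  simp only [add_dotProduct, dotProduct_add, dotProduct_comm B' A]
  ring

theorem weyl_chirp (A B : Fin n → ℂ) (s : ℝ) (G : GaussianSum n) :
    weyl A B (chirp s G) = chirp s (weyl A (B + (2 * Complex.I * s) • A) G) := by
  ext Z
  simp only [weyl_apply, chirp_apply, ← mul_assoc, ← Complex.exp_add]
  congr 2
  simp only [add_dotProduct, dotProduct_add, smul_dotProduct, dotProduct_smul, smul_eq_mul,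
    dotProduct_comm Z A]
  ring

theorem surjective_chirp (s : ℝ) :
    Function.Surjective (chirp s : GaussianSum n → GaussianSum n) := by
  refine fun G => ⟨chirp (-s) G, ?_⟩
  ext Z
  simp [chirp_apply, ← mul_assoc, ← Complex.exp_add]

theorem surjective_weyl (A B : Fin n → ℂ) : Function.Surjective (weyl A B) := fun G =>
  ⟨weyl (-A) (-B) G, by simp [weyl_weyl, weyl_zero_zero, dotProduct_comm]⟩

theorem GaussianSum.exists_norm_weyl_le (G : GaussianSum n) {K : Set ((Fin n → ℂ) × (Fin n → ℂ))}
    (hK : IsCompact K) : ∃ C r : ℝ, 0 ≤ C ∧ 0 < r ∧ ∀ p ∈ K, ∀ x : Rn n,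
      ‖(weyl p.1 p.2 G).1 (toC x)‖ ≤ C * Real.exp (-r * ‖x‖ ^ 2) := by
  induction G using GaussianSum.induction with
  | cgauss q w hq =>
    have := continuous_dotProduct (n := n)
    obtain ⟨C, hC⟩ := hK.exists_bound_of_continuousOn (f := fun p : (Fin n → ℂ) × (Fin n → ℂ) =>
      ‖Complex.exp (-q * (p.1 ⬝ᵥ p.1) + w ⬝ᵥ p.1 + p.1 ⬝ᵥ p.2 / 2)‖ *
        Real.exp ((n * ‖w + p.2 - (2 * q) • p.1‖) ^ 2 / (2 * q.re))) (by fun_prop)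
    refine ⟨|C|, q.re / 2, abs_nonneg C, by positivity, fun p hp x => ?_⟩
    rw [weyl_apply, exp_mul_cgauss_add, norm_mul]
    refine (mul_le_mul_of_nonneg_left (norm_cgauss_toC_le hq _ x) (norm_nonneg _)).trans ?_
    rw [← mul_assoc]
    gcongr
    exact (le_abs_self _).trans ((hC p hp).trans (le_abs_self C))
  | zero => exact ⟨0, 1, le_rfl, one_pos, fun p _ x => by simp⟩
  | add G H hG hH =>
    obtain ⟨C, r, hC, hr, h⟩ := hG
    obtain ⟨C', r', hC', hr', h'⟩ := hH
    refine ⟨C + C', min r r', by positivity, lt_min hr hr', fun p hp x => ?_⟩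
    rw [map_add, Submodule.coe_add, Pi.add_apply, add_mul]
    refine norm_add_le_of_le ((h p hp x).trans ?_) ((h' p hp x).trans ?_)
    · gcongr; exact min_le_left _ _
    · gcongr; exact min_le_right _ _
  | smul c G hG =>
    obtain ⟨C, r, hC, hr, h⟩ := hG
    refine ⟨‖c‖ * C, r, by positivity, hr, fun p hp x => ?_⟩
    rw [map_smul, Submodule.coe_smul, Pi.smul_apply, norm_smul, mul_assoc]
    gcongr
    exact h p hp x

theorem GaussianSum.exists_norm_le (G : GaussianSum n) : ∃ C r : ℝ, 0 < r ∧ ∀ x : Rn n,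
    ‖G.1 (toC x)‖ ≤ C * Real.exp (-r * ‖x‖ ^ 2) := by
  obtain ⟨C, r, -, hr, h⟩ := GaussianSum.exists_norm_weyl_le G (isCompact_singleton (x := 0))
  exact ⟨C, r, hr, fun x => by simpa [weyl_zero_zero] using h 0 rfl x⟩

theorem GaussianSum.continuous_comp_toC (G : GaussianSum n) :
    Continuous fun x : Rn n => G.1 (toC x) :=
  (GaussianSum.differentiable G).continuous.comp continuous_toC

theorem GaussianSum.integrable (G : GaussianSum n) : Integrable fun x : Rn n => G.1 (toC x) := by
  obtain ⟨C, r, hr, h⟩ := GaussianSum.exists_norm_le G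
  exact ((integrable_exp_neg_mul_norm_sq hr).const_mul C).mono'
    (GaussianSum.continuous_comp_toC G).aestronglyMeasurable (Filter.Eventually.of_forall h)

theorem GaussianSum.memLp (G : GaussianSum n) : MemLp (fun x : Rn n => G.1 (toC x)) 2 volume := by
  obtain ⟨C, r, hr, h⟩ := GaussianSum.exists_norm_le G
  exact ((memLp_exp_neg_mul_norm_sq hr).const_mul C).of_le
    (GaussianSum.continuous_comp_toC G).aestronglyMeasurable
    (Filter.Eventually.of_forall fun x => (h x).trans (le_abs_self _))

/-- The restriction to `ℝⁿ` of a sum of Gaussians, as an element of `L²`. -/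
noncomputable def GaussianSum.toL2 : GaussianSum n →ₗ[ℂ] L2Rn n where
  toFun G := (GaussianSum.memLp G).toLp
  map_add' _ _ := rfl
  map_smul' _ _ := rfl

theorem GaussianSum.coeFn_toL2 (G : GaussianSum n) :
    GaussianSum.toL2 G =ᵐ[volume] fun x => G.1 (toC x) :=
  (GaussianSum.memLp G).coeFn_toLp

theorem GaussianSum.norm_toL2_eq_of_norm_eq {G H : GaussianSum n} {a : Rn n}
    (h : ∀ x, ‖G.1 (toC x)‖ = ‖H.1 (toC (x + a))‖) :
    ‖GaussianSum.toL2 G‖ = ‖GaussianSum.toL2 H‖ := by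
  change ‖(GaussianSum.memLp G).toLp‖ = ‖(GaussianSum.memLp H).toLp‖
  rw [Lp.norm_toLp, Lp.norm_toLp]
  congr 1
  calc eLpNorm (fun x => G.1 (toC x)) 2 volume
      = eLpNorm ((fun x => H.1 (toC x)) ∘ (· + a)) 2 volume :=
        eLpNorm_congr_norm_ae (Filter.Eventually.of_forall h)
    _ = eLpNorm (fun x => H.1 (toC x)) 2 volume :=
        eLpNorm_comp_measurePreserving (GaussianSum.continuous_comp_toC H).aestronglyMeasurable
          (measurePreserving_add_right volume a)

theorem norm_toL2_chirp (s : ℝ) (G : GaussianSum n) :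
    ‖GaussianSum.toL2 (chirp s G)‖ = ‖GaussianSum.toL2 G‖ :=
  GaussianSum.norm_toL2_eq_of_norm_eq (a := 0) fun x => by
    rw [chirp_apply, norm_mul, toC_dotProduct_self, add_zero, Complex.norm_exp]
    simp [-Complex.ofReal_pow]

theorem norm_toL2_weyl_I_smul (a b : Rn n) (G : GaussianSum n) :
    ‖GaussianSum.toL2 (weyl (toC a) (Complex.I • toC b) G)‖ = ‖GaussianSum.toL2 G‖ :=
  GaussianSum.norm_toL2_eq_of_norm_eq (a := a) fun x => by
    rw [weyl_apply, norm_mul, smul_dotProduct, dotProduct_smul, toC_dotProduct, toC_dotProduct,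
      Complex.norm_exp, toC_add]
    simp

theorem inner_star_toL2 (φ : L2Rn n) (G : GaussianSum n) :
    ⟪star φ, GaussianSum.toL2 G⟫_ℂ = ∫ x, φ x * G.1 (toC x) := by
  rw [inner_star_left_eq_integral]
  refine integral_congr_ae ?_
  filter_upwards [GaussianSum.coeFn_toL2 G] with x hx
  rw [hx]

end Operators

section GaussianFourier

variable {n : ℕ}

theorem re_pi_sq_div_pos {q : ℂ} (hq : 0 < q.re) : 0 < ((Real.pi : ℂ) ^ 2 / q).re := by
  rw [← Complex.ofReal_pow, Complex.div_re]
  have : 0 < Complex.normSq q := Complex.normSq_pos.2 (by rintro rfl; simp at hq)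
  simp only [Complex.ofReal_re, Complex.ofReal_im, zero_mul, zero_div, add_zero]
  positivity

theorem integral_weyl_cgauss {q : ℂ} (hq : 0 < q.re) (w Z : Fin n → ℂ) :
    ∫ x : Rn n, (weyl 0 ((2 * Real.pi * Complex.I) • Z) ⟨cgauss q w, cgauss_mem hq w⟩).1 (toC x)
      = (Real.pi / q) ^ (n / 2 : ℂ) * Complex.exp ((w ⬝ᵥ w) / (4 * q)) *
        cgauss (Real.pi ^ 2 / q) ((Complex.I * Real.pi / q) • w) Z := by
  have hq0 : q ≠ 0 := by rintro rfl; simp at hq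
  simp only [weyl_apply, exp_mul_cgauss_add, integral_const_mul, integral_cgauss hq]
  rw [mul_left_comm, mul_assoc ((_ : ℂ) ^ _)]
  congr 1
  simp only [cgauss, ← Complex.exp_add]
  congr 1
  simp only [dotProduct_zero, zero_dotProduct, smul_zero, sub_zero, add_dotProduct, dotProduct_add,
    smul_dotProduct, dotProduct_smul, smul_eq_mul, dotProduct_comm Z w]
  field_simp
  ring_nf
  simp only [Complex.I_sq]
  ring

theorem integral_weyl_mem_gaussianSum (G : GaussianSum n) :
    (fun Z => ∫ x : Rn n, (weyl 0 ((2 * Real.pi * Complex.I) • Z) G).1 (toC x))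
      ∈ GaussianSum n := by
  induction G using GaussianSum.induction with
  | cgauss q w hq =>
    simp only [integral_weyl_cgauss hq]
    exact (GaussianSum n).smul_mem _ (cgauss_mem (re_pi_sq_div_pos hq) _)
  | zero =>
    convert zero_mem (GaussianSum n)
    simp
  | add G H hG hH =>
    convert add_mem hG hH using 2 with Z
    simp only [map_add, Submodule.coe_add, Pi.add_apply]
    exact integral_add (GaussianSum.integrable _) (GaussianSum.integrable _)
  | smul c G hG =>
    convert (GaussianSum n).smul_mem c hG using 2 with Z
    simp only [map_smul, Submodule.coe_smul, Pi.smul_apply]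
    exact integral_smul _ _

/-- The inverse Fourier transform with kernel `e^{2πi x·ζ}` on sums of Gaussians, evaluated at all
complex points. -/
noncomputable def gaussFourierInv : GaussianSum n →ₗ[ℂ] GaussianSum n where
  toFun G := ⟨_, integral_weyl_mem_gaussianSum G⟩
  map_add' G H := by
    ext Z
    simp only [map_add, Submodule.coe_add, Pi.add_apply]
    exact integral_add (GaussianSum.integrable _) (GaussianSum.integrable _)
  map_smul' c G := by
    ext Z
    simp only [map_smul, Submodule.coe_smul, Pi.smul_apply]
    exact integral_smul _ _

theorem gaussFourierInv_apply (G : GaussianSum n) (Z : Fin n → ℂ) :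
    (gaussFourierInv G).1 Z
      = ∫ x : Rn n, (weyl 0 ((2 * Real.pi * Complex.I) • Z) G).1 (toC x) := rfl

theorem weyl_gaussFourierInv (a : Rn n) (G : GaussianSum n) :
    weyl (-Complex.I • toC a) 0 (gaussFourierInv G)
      = gaussFourierInv (weyl 0 ((2 * Real.pi : ℂ) • toC a) G) := by
  ext Z
  rw [weyl_apply, gaussFourierInv_apply, gaussFourierInv_apply]
  simp only [weyl_weyl, zero_dotProduct, dotProduct_zero, add_zero, zero_div,
    Complex.exp_zero, one_smul, one_mul, sub_zero, smul_add, smul_smul]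
  congr! 6
  ring_nf
  simp

theorem surjective_gaussFourierInv :
    Function.Surjective (gaussFourierInv : GaussianSum n → GaussianSum n) := by
  intro G
  change G ∈ LinearMap.range gaussFourierInv
  induction G using GaussianSum.induction with
  | cgauss q w hq =>
    have hq0 : q ≠ 0 := by rintro rfl; simp at hq
    have hpi : (Real.pi : ℂ) ≠ 0 := by simp [Real.pi_ne_zero]
    have hw : (Complex.I * Real.pi / (Real.pi ^ 2 / q)) • (-(Complex.I * Real.pi / q)) • w = w := by
      rw [smul_smul]
      convert one_smul ℂ w using 2
      field_simp
      simp
    have hq' : (Real.pi : ℂ) ^ 2 / (Real.pi ^ 2 / q) = q := by field_simp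
    set w' := (-(Complex.I * Real.pi / q)) • w
    have hc : (Real.pi / (Real.pi ^ 2 / q)) ^ (n / 2 : ℂ) *
        Complex.exp ((w' ⬝ᵥ w') / (4 * (Real.pi ^ 2 / q))) ≠ 0 := by
      simp [Complex.cpow_eq_zero_iff, Complex.exp_ne_zero, hq0, hpi]
    refine (LinearMap.range _).smul_mem_iff hc |>.1
      ⟨⟨_, cgauss_mem (re_pi_sq_div_pos hq) w'⟩, ?_⟩
    ext Z
    rw [gaussFourierInv_apply, integral_weyl_cgauss (re_pi_sq_div_pos hq), hw, hq']
    rfl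
  | zero => exact zero_mem _
  | add G H hG hH => exact add_mem hG hH
  | smul c G hG => exact Submodule.smul_mem _ c hG

theorem toL2_gaussFourierInv (G : GaussianSum n) :
    GaussianSum.toL2 (gaussFourierInv G) = 𝓕⁻ (GaussianSum.toL2 G) := by
  refine Lp.ext ?_
  filter_upwards [GaussianSum.coeFn_toL2 (gaussFourierInv G),
    fourierInv_toLp_ae_eq (GaussianSum.integrable G) (GaussianSum.memLp G)] with x hx hx'
  rw [hx]
  refine Eq.trans ?_ hx'.symm
  rw [gaussFourierInv_apply, Real.fourierInv_eq']
  refine integral_congr_ae (Filter.Eventually.of_forall fun y => ?_)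
  simp only [weyl_apply, smul_eq_mul, zero_dotProduct, zero_div, add_zero, smul_dotProduct,
    toC_dotProduct, real_inner_comm x y]
  push_cast
  ring_nf

theorem norm_toL2_gaussFourierInv (G : GaussianSum n) :
    ‖GaussianSum.toL2 (gaussFourierInv G)‖ = ‖GaussianSum.toL2 G‖ := by
  rw [toL2_gaussFourierInv]
  exact LinearIsometryEquiv.norm_map (Lp.fourierTransformₗᵢ (Rn n) ℂ).symm _

end GaussianFourier

section WeylNorm

variable {n : ℕ}

theorem ae_eq_of_forall_integral_gaussianSum {f g : Rn n → ℂ}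
    (hf : ∀ G : GaussianSum n, Integrable fun x => f x * G.1 (toC x))
    (hg : ∀ G : GaussianSum n, Integrable fun x => g x * G.1 (toC x))
    (h : ∀ G : GaussianSum n, ∫ x, f x * G.1 (toC x) = ∫ x, g x * G.1 (toC x)) :
    f =ᵐ[volume] g := by
  let γ : GaussianSum n := ⟨cgauss 1 0, cgauss_mem (by simp) 0⟩
  have hint (G : GaussianSum n) : Integrable fun x => (f x - g x) * G.1 (toC x) := by
    simpa only [sub_mul] using! (hf G).sub (hg G)
  have hzero : (fun x => (f x - g x) * γ.1 (toC x)) =ᵐ[volume] 0 := by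
    refine ae_eq_zero_of_fourierInv_eq_zero (hint γ) (funext fun k => ?_)
    have hk := integral_sub (hf (weyl 0 ((2 * Real.pi * Complex.I) • toC k) γ))
      (hg (weyl 0 ((2 * Real.pi * Complex.I) • toC k) γ))
    rw [h, sub_self] at hk
    rw [Real.fourierInv_eq', Pi.zero_apply, ← hk]
    refine integral_congr_ae (Filter.Eventually.of_forall fun x => ?_)
    simp only [weyl_apply, smul_eq_mul, zero_dotProduct, zero_div, add_zero, smul_dotProduct,
      toC_dotProduct, real_inner_comm x k]
    push_cast
    ring_nf
  filter_upwards [hzero] with x hx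
  exact sub_eq_zero.1 ((mul_eq_zero.1 hx).resolve_right (Complex.exp_ne_zero _))

theorem integrable_mul_gaussianSum {f : Rn n → ℂ} (hf : MemLp f 2 volume) (G : GaussianSum n) :
    Integrable fun x => f x * G.1 (toC x) :=
  hf.integrable_mul (GaussianSum.memLp G)

theorem eq_zero_of_forall_inner_star_toL2 {φ : L2Rn n}
    (h : ∀ G : GaussianSum n, ⟪star φ, GaussianSum.toL2 G⟫_ℂ = 0) : φ = 0 := by
  refine (Lp.eq_zero_iff_ae_eq_zero).2 (ae_eq_of_forall_integral_gaussianSum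
    (integrable_mul_gaussianSum (Lp.memLp φ)) (integrable_mul_gaussianSum MemLp.zero) fun G => ?_)
  simp [← inner_star_toL2, h G]

/-- The weighted norm `‖e^{a·x} f‖` in `L²(ℝⁿ)`. -/
noncomputable def expNorm (a : Rn n) (f : Rn n → ℂ) : ℝ≥0∞ :=
  eLpNorm (fun x => (Real.exp ⟪a, x⟫_ℝ : ℂ) * f x) 2 volume

/-- The norm in `L²(ℝⁿ)` of the transpose of `weyl (-i c) b` applied to `φ`, that is, formally, of
`exp(b·x + i c·∇) φ`. It is defined by duality with sums of Gaussians, so as to make sense, with the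
value `∞`, when `φ` is not in the domain of that unbounded operator. -/
noncomputable def weylNorm (φ : L2Rn n) (c b : Rn n) : ℝ≥0∞ :=
  ⨆ G : GaussianSum n, ‖⟪star φ, GaussianSum.toL2 (weyl (-Complex.I • toC c) (toC b) G)⟫_ℂ‖ₑ /
    ‖GaussianSum.toL2 G‖ₑ

theorem weylNorm_le_coe_iff {φ : L2Rn n} {c b : Rn n} {N : NNReal} :
    weylNorm φ c b ≤ N ↔ ∀ G : GaussianSum n,
      ‖⟪star φ, GaussianSum.toL2 (weyl (-Complex.I • toC c) (toC b) G)⟫_ℂ‖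
        ≤ N * ‖GaussianSum.toL2 G‖ := by
  refine iSup_le_iff.trans (forall_congr' fun G => ?_)
  rw [ENNReal.div_le_iff_le_mul (.inr ENNReal.coe_ne_top) (.inl enorm_ne_top)]
  simp only [enorm_eq_nnnorm, ← coe_nnnorm]
  norm_cast

theorem inner_star_toL2_weyl_zero (φ : L2Rn n) (b : Rn n) (G : GaussianSum n) :
    ⟪star φ, GaussianSum.toL2 (weyl (-Complex.I • toC 0) (toC b) G)⟫_ℂ
      = ∫ x, (Real.exp ⟪b, x⟫_ℝ : ℂ) * φ x * G.1 (toC x) := by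
  rw [inner_star_toL2]
  refine integral_congr_ae (Filter.Eventually.of_forall fun x => ?_)
  simp only [weyl_apply, toC_zero, smul_zero, zero_dotProduct, zero_div, add_zero, toC_dotProduct,
    Complex.ofReal_exp]
  ring

theorem aestronglyMeasurable_exp_inner_mul {f : Rn n → ℂ} (hf : AEStronglyMeasurable f volume)
    (b : Rn n) : AEStronglyMeasurable (fun x => (Real.exp ⟪b, x⟫_ℝ : ℂ) * f x) volume :=
  Continuous.aestronglyMeasurable (by fun_prop) |>.mul hf

theorem expNorm_le_of_weylNorm_le {φ : L2Rn n} {b : Rn n} {N : NNReal}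
    (h : weylNorm φ 0 b ≤ N) : expNorm b φ ≤ N := by
  obtain ⟨ψ, hψ, hpair⟩ := exists_eq_inner_of_forall_norm_le (GaussianSum.toL2 (n := n))
    ((innerₛₗ ℂ (star φ)) ∘ₗ GaussianSum.toL2 ∘ₗ weyl (-Complex.I • toC 0) (toC b)) N.2
    (weylNorm_le_coe_iff.1 h)
  have hint (G : GaussianSum n) :
      Integrable fun x => (Real.exp ⟪b, x⟫_ℝ : ℂ) * φ x * G.1 (toC x) := by
    refine (integrable_mul_gaussianSum (Lp.memLp φ) (weyl 0 (toC b) G)).congr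
      (Filter.Eventually.of_forall fun x => ?_)
    simp only [weyl_apply, zero_dotProduct, zero_div, add_zero, toC_dotProduct, Complex.ofReal_exp]
    ring
  have hdual : (fun x => (Real.exp ⟪b, x⟫_ℝ : ℂ) * φ x) =ᵐ[volume] (star ψ : L2Rn n) := by
    refine ae_eq_of_forall_integral_gaussianSum hint (integrable_mul_gaussianSum (Lp.memLp _))
      fun G => ?_
    rw [← inner_star_toL2, star_star, ← hpair G, ← inner_star_toL2_weyl_zero]
    rfl
  rw [expNorm, eLpNorm_congr_ae hdual, eLpNorm_congr_ae (Lp.coeFn_star ψ), eLpNorm_star,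
    ← Lp.enorm_def]
  exact enorm_le_coe.2 hψ

theorem weylNorm_le_of_expNorm_le {φ : L2Rn n} {b : Rn n} {N : NNReal}
    (h : expNorm b φ ≤ N) : weylNorm φ 0 b ≤ N := by
  have hmem : MemLp (fun x => (Real.exp ⟪b, x⟫_ℝ : ℂ) * φ x) 2 volume :=
    ⟨aestronglyMeasurable_exp_inner_mul (Lp.aestronglyMeasurable φ) b,
      h.trans_lt ENNReal.coe_lt_top⟩
  refine weylNorm_le_coe_iff.2 fun G => ?_
  have hpair : ⟪star φ, GaussianSum.toL2 (weyl (-Complex.I • toC 0) (toC b) G)⟫_ℂ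
      = ⟪star hmem.toLp, GaussianSum.toL2 G⟫_ℂ := by
    rw [inner_star_toL2_weyl_zero, inner_star_toL2]
    refine integral_congr_ae ?_
    filter_upwards [hmem.coeFn_toLp] with x hx
    rw [hx]
  rw [hpair]
  refine (norm_inner_star_left_le _ _).trans ?_
  gcongr
  rw [Lp.norm_toLp]
  exact ENNReal.toReal_le_coe_of_le_coe h

theorem weylNorm_zero_left (φ : L2Rn n) (b : Rn n) : weylNorm φ 0 b = expNorm b φ :=
  ENNReal.eq_of_forall_le_nnreal_iff fun _ =>
    ⟨expNorm_le_of_weylNorm_le, weylNorm_le_of_expNorm_le⟩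

theorem weylNorm_fourier (φ : L2Rn n) (a : Rn n) :
    weylNorm (𝓕 φ) a 0 = weylNorm φ 0 ((2 * Real.pi) • a) := by
  refine (surjective_gaussFourierInv.iSup_congr _ fun G => ?_).symm
  simp only [← ofReal_norm]
  rw [norm_toL2_gaussFourierInv, toC_zero, weyl_gaussFourierInv, toL2_gaussFourierInv,
    ← inner_star_fourierInv_left, fourierInv_fourier_eq, smul_zero, toC_smul]
  push_cast
  rfl

theorem eq_zero_of_weylNorm_eq_zero {φ : L2Rn n} {c b : Rn n} (h : weylNorm φ c b = 0) :
    φ = 0 := by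
  have hpair := weylNorm_le_coe_iff (N := 0) |>.1 h.le
  refine eq_zero_of_forall_inner_star_toL2 fun G => ?_
  obtain ⟨G, rfl⟩ := surjective_weyl (-Complex.I • toC c) (toC b) G
  simpa using hpair G

theorem weylNorm_zero (c b : Rn n) : weylNorm (0 : L2Rn n) c b = 0 :=
  nonpos_iff_eq_zero.1 <| weylNorm_le_coe_iff (N := 0) |>.2 fun G =>
    (norm_inner_star_left_le _ _).trans (by simp)

end WeylNorm

section LogConvexity

variable {n : ℕ}

theorem weyl_comm (A B A' B' : Fin n → ℂ) (G : GaussianSum n) :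
    weyl A B (weyl A' B' G)
      = Complex.exp (A ⬝ᵥ B' - A' ⬝ᵥ B) • weyl A' B' (weyl A B G) := by
  rw [weyl_weyl, weyl_weyl, smul_smul, ← Complex.exp_add, add_comm A', add_comm B']
  congr 2
  ring

theorem exists_norm_toL2_weyl_le (G : GaussianSum n) {K : Set ((Fin n → ℂ) × (Fin n → ℂ))}
    (hK : IsCompact K) :
    ∃ C : ℝ, ∀ p ∈ K, ‖GaussianSum.toL2 (weyl p.1 p.2 G)‖ ≤ C := by
  obtain ⟨C, r, -, hr, h⟩ := GaussianSum.exists_norm_weyl_le G hK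
  have hg := memLp_exp_neg_mul_norm_sq (n := n) hr
  refine ⟨C * ‖hg.toLp‖, fun p hp => Lp.norm_le_mul_norm_of_ae_le_mul ?_⟩
  filter_upwards [GaussianSum.coeFn_toL2 (weyl p.1 p.2 G), hg.coeFn_toLp] with x hx hgx
  rw [hx, hgx, Real.norm_of_nonneg (Real.exp_pos _).le]
  exact h p hp x

theorem differentiable_inner_star_toL2_weyl (φ : L2Rn n) (G : GaussianSum n) {A B : ℂ → Fin n → ℂ}
    (hA : Differentiable ℂ A) (hB : Differentiable ℂ B) :
    Differentiable ℂ fun z => ⟪star φ, GaussianSum.toL2 (weyl (A z) (B z) G)⟫_ℂ := by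
  simp only [inner_star_toL2]
  refine differentiable_integral_of_dominated (Filter.Eventually.of_forall fun x => ?_)
    (fun z => (integrable_mul_gaussianSum (Lp.memLp φ) _).aestronglyMeasurable) fun R => ?_
  · have hG := GaussianSum.differentiable G
    simp only [weyl_apply, dotProduct]
    fun_prop
  · obtain ⟨C, r, -, hr, h⟩ := GaussianSum.exists_norm_weyl_le G
      ((isCompact_closedBall (0 : ℂ) R).image (hA.continuous.prodMk hB.continuous))
    refine ⟨fun x => ‖φ x‖ * (C * Real.exp (-r * ‖x‖ ^ 2)), (Lp.memLp φ).norm.integrable_mul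
      ((memLp_exp_neg_mul_norm_sq hr).const_mul C), Filter.Eventually.of_forall fun x z hz => ?_⟩
    rw [norm_mul]
    exact mul_le_mul_of_nonneg_left (h _ ⟨z, hz, rfl⟩ x) (norm_nonneg _)

/-- The pairing of `φ` with `weyl (-i (c + zγ)) (b + zβ) G`, as an entire function of `z`. The
exponential prefactor compensates the phase of the commutation relations, so that the modulus on a
vertical line is that of a pairing with a real translate and modulation of `G`. -/
noncomputable def weylLine (φ : L2Rn n) (c γ b β : Rn n) (G : GaussianSum n) (z : ℂ) : ℂ :=
  Complex.exp (-(Complex.I * ((⟪c, β⟫_ℝ - ⟪γ, b⟫_ℝ) / 2 : ℝ) * z)) *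
    ⟪star φ, GaussianSum.toL2 (weyl (-Complex.I • (toC c + z • toC γ)) (toC b + z • toC β) G)⟫_ℂ

theorem differentiable_weylLine (φ : L2Rn n) (c γ b β : Rn n) (G : GaussianSum n) :
    Differentiable ℂ (weylLine φ c γ b β G) :=
  (by fun_prop : Differentiable ℂ fun z : ℂ =>
      Complex.exp (-(Complex.I * ((⟪c, β⟫_ℝ - ⟪γ, b⟫_ℝ) / 2 : ℝ) * z))).mul
    (differentiable_inner_star_toL2_weyl φ G (by fun_prop) (by fun_prop))

theorem symplectic_line (c γ b β : Rn n) (x y : ℝ) :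
    (-Complex.I • toC (c + x • γ)) ⬝ᵥ (Complex.I • toC (y • β)) - toC (y • γ) ⬝ᵥ toC (b + x • β)
      = (y * (⟪c, β⟫_ℝ - ⟪γ, b⟫_ℝ) : ℝ) := by
  simp only [smul_dotProduct, dotProduct_smul, toC_dotProduct, smul_eq_mul, inner_add_left,
    inner_add_right, real_inner_smul_left, real_inner_smul_right]
  push_cast
  linear_combination (-y * (⟪c, β⟫_ℝ + x * ⟪γ, β⟫_ℝ) : ℂ) * Complex.I_mul_I

theorem norm_weylLine (φ : L2Rn n) (c γ b β : Rn n) (G : GaussianSum n) (z : ℂ) :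
    ‖weylLine φ c γ b β G z‖
      = ‖⟪star φ, GaussianSum.toL2 (weyl (-Complex.I • toC (c + z.re • γ)) (toC (b + z.re • β))
          (weyl (toC (z.im • γ)) (Complex.I • toC (z.im • β)) G))⟫_ℂ‖ := by
  have hA : -Complex.I • toC (c + z.re • γ) + toC (z.im • γ)
      = -Complex.I • (toC c + z • toC γ) := by
    ext i
    simp only [toC_add, toC_smul, Pi.add_apply, Pi.smul_apply, smul_eq_mul]
    linear_combination -Complex.I * toC γ i * Complex.re_add_im z +
      toC γ i * z.im * Complex.I_mul_I
  have hB : toC (b + z.re • β) + Complex.I • toC (z.im • β) = toC b + z • toC β := by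
    ext i
    simp only [toC_add, toC_smul, Pi.add_apply, Pi.smul_apply, smul_eq_mul]
    linear_combination toC β i * Complex.re_add_im z
  rw [weyl_weyl, symplectic_line, hA, hB, map_smul, inner_smul_right, weylLine, norm_mul, norm_mul,
    Complex.norm_exp, Complex.norm_exp]
  congr 2
  simp
  ring

theorem norm_weylLine_le (φ : L2Rn n) (c γ b β : Rn n) (G : GaussianSum n) {N : NNReal} {z : ℂ}
    (h : weylNorm φ (c + z.re • γ) (b + z.re • β) ≤ N) :
    ‖weylLine φ c γ b β G z‖ ≤ N * ‖GaussianSum.toL2 G‖ := by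
  rw [norm_weylLine, ← norm_toL2_weyl_I_smul (z.im • γ) (z.im • β) G]
  exact weylNorm_le_coe_iff.1 h _

theorem exists_norm_toL2_weyl_segment_le (c γ b β : Rn n) (G : GaussianSum n) :
    ∃ C : ℝ, ∀ x ∈ Set.Icc (0 : ℝ) 1,
      ‖GaussianSum.toL2 (weyl (-Complex.I • toC (c + x • γ)) (toC (b + x • β)) G)‖ ≤ C := by
  have hcont : Continuous fun x : ℝ => (-Complex.I • toC (c + x • γ), toC (b + x • β)) :=
    (continuous_const_smul (-Complex.I) |>.comp <|
      continuous_toC.comp (f := fun x : ℝ => c + x • γ) (by fun_prop)).prodMk <|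
      continuous_toC.comp (f := fun x : ℝ => b + x • β) (by fun_prop)
  obtain ⟨C, hC⟩ := exists_norm_toL2_weyl_le G (isCompact_Icc.image hcont)
  exact ⟨C, fun x hx => hC (_, _) (Set.mem_image_of_mem _ hx)⟩

theorem exists_norm_weylLine_le (φ : L2Rn n) (c γ b β : Rn n) (G : GaussianSum n) :
    ∃ C k : ℝ, ∀ z : ℂ, z.re ∈ Set.Icc 0 1 →
      ‖weylLine φ c γ b β G z‖ ≤ C * Real.exp (k * |z.im|) := by
  obtain ⟨C, hC⟩ := exists_norm_toL2_weyl_segment_le c γ b β G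
  refine ⟨‖φ‖ * C, |⟪c, β⟫_ℝ - ⟪γ, b⟫_ℝ|, fun z hz => ?_⟩
  have hexp : z.im * (⟪c, β⟫_ℝ - ⟪γ, b⟫_ℝ) ≤ |⟪c, β⟫_ℝ - ⟪γ, b⟫_ℝ| * |z.im| := by
    rw [← abs_mul, mul_comm]
    exact le_abs_self _
  rw [norm_weylLine, weyl_comm, symplectic_line, map_smul, inner_smul_right, norm_mul,
    Complex.norm_exp, Complex.ofReal_re, mul_comm]
  refine mul_le_mul ((norm_inner_star_left_le φ _).trans ?_) (Real.exp_le_exp.2 hexp)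
    (Real.exp_pos _).le (mul_nonneg (norm_nonneg _) ((norm_nonneg _).trans (hC _ hz)))
  rw [norm_toL2_weyl_I_smul]
  exact mul_le_mul_of_nonneg_left (hC _ hz) (norm_nonneg _)

theorem weylNorm_line_le_coe {φ : L2Rn n} {c γ b β : Rn n} {N₀ N₁ : NNReal}
    (h₀ : weylNorm φ c b ≤ N₀) (h₁ : weylNorm φ (c + γ) (b + β) ≤ N₁) {x : ℝ}
    (hx : x ∈ Set.Icc 0 1) :
    weylNorm φ (c + x • γ) (b + x • β) ≤ (N₀ ^ (1 - x) * N₁ ^ x : NNReal) := by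
  refine weylNorm_le_coe_iff.2 fun G => ?_
  obtain ⟨C, k, hgrowth⟩ := exists_norm_weylLine_le φ c γ b β G
  have hline := norm_le_interp_of_exponential_growth (z := x) (differentiable_weylLine φ c γ b β G)
    hgrowth (fun z hz => norm_weylLine_le φ c γ b β G (z := z) (by simpa [hz] using h₀))
    (fun z hz => norm_weylLine_le φ c γ b β G (z := z) (by simpa [hz] using h₁)) hx
  rw [norm_weylLine] at hline
  simp only [Complex.ofReal_re, Complex.ofReal_im, zero_smul, toC_zero, smul_zero,
    weyl_zero_zero] at hline
  refine hline.trans_eq ?_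
  rw [Real.mul_rpow N₀.coe_nonneg (norm_nonneg _),
    Real.mul_rpow N₁.coe_nonneg (norm_nonneg _), mul_mul_mul_comm,
    ← Real.rpow_add_of_nonneg (norm_nonneg _) (sub_nonneg.2 hx.2) hx.1, sub_add_cancel,
    Real.rpow_one]
  rfl

theorem weylNorm_line_le (φ : L2Rn n) (c γ b β : Rn n) {x : ℝ} (hx : x ∈ Set.Icc 0 1) :
    weylNorm φ (c + x • γ) (b + x • β)
      ≤ weylNorm φ c b ^ (1 - x) * weylNorm φ (c + γ) (b + β) ^ x := by
  rcases hx.1.eq_or_lt with rfl | hx₀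
  · simp
  rcases hx.2.eq_or_lt with rfl | hx₁
  · simp
  rcases eq_or_ne φ 0 with rfl | hφ
  · simp [weylNorm_zero]
  have h₀ : weylNorm φ c b ^ (1 - x) ≠ 0 := (ENNReal.rpow_pos_of_nonneg
    (pos_iff_ne_zero.2 fun h => hφ (eq_zero_of_weylNorm_eq_zero h)) (sub_nonneg.2 hx.2)).ne'
  have h₁ : weylNorm φ (c + γ) (b + β) ^ x ≠ 0 := (ENNReal.rpow_pos_of_nonneg
    (pos_iff_ne_zero.2 fun h => hφ (eq_zero_of_weylNorm_eq_zero h)) hx.1).ne'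
  rcases eq_or_ne (weylNorm φ c b) ⊤ with htop | hN₀
  · rw [htop, ENNReal.top_rpow_of_pos (sub_pos.2 hx₁), ENNReal.top_mul h₁]
    exact le_top
  rcases eq_or_ne (weylNorm φ (c + γ) (b + β)) ⊤ with htop | hN₁
  · rw [htop, ENNReal.top_rpow_of_pos hx₀, ENNReal.mul_top h₀]
    exact le_top
  have h := weylNorm_line_le_coe (ENNReal.coe_toNNReal hN₀).ge (ENNReal.coe_toNNReal hN₁).ge hx
  rwa [ENNReal.coe_mul, ENNReal.coe_rpow_of_nonneg _ (sub_nonneg.2 hx.2),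
    ENNReal.coe_rpow_of_nonneg _ hx.1, ENNReal.coe_toNNReal hN₀, ENNReal.coe_toNNReal hN₁] at h

end LogConvexity

section Schrodinger

variable {n : ℕ}

theorem fourier_freeSchrodinger_ae_eq (t : ℝ) (u : L2Rn n) :
    (𝓕 (freeSchrodinger t u) : L2Rn n) =ᵐ[volume]
      fun y => schrodingerSymbol t y * (𝓕 u : L2Rn n) y := by
  rw [freeSchrodinger, fourier_fourierInv_eq]
  exact MemLp.coeFn_toLp _

theorem freeSchrodinger_zero (u : L2Rn n) : freeSchrodinger 0 u = u := by
  have h : (𝓕 (freeSchrodinger 0 u) : L2Rn n) = 𝓕 u := by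
    refine Lp.ext ?_
    filter_upwards [fourier_freeSchrodinger_ae_eq 0 u] with y hy
    simp [hy, schrodingerSymbol]
  exact (Lp.fourierTransformₗᵢ (Rn n) ℂ).injective h

theorem schrodingerSymbol_eq_exp_toC (t : ℝ) (y : Rn n) :
    schrodingerSymbol t y
      = Complex.exp (Complex.I * (-(2 * Real.pi) ^ 2 * t : ℝ) * (toC y ⬝ᵥ toC y)) := by
  rw [schrodingerSymbol, toC_dotProduct_self]
  congr 1
  push_cast
  ring

theorem inner_star_fourier_freeSchrodinger (t : ℝ) (u : L2Rn n) (G : GaussianSum n) :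
    ⟪star (𝓕 (freeSchrodinger t u) : L2Rn n), GaussianSum.toL2 G⟫_ℂ
      = ⟪star (𝓕 u : L2Rn n), GaussianSum.toL2 (chirp (-(2 * Real.pi) ^ 2 * t) G)⟫_ℂ := by
  rw [inner_star_toL2, inner_star_toL2]
  refine integral_congr_ae ?_
  filter_upwards [fourier_freeSchrodinger_ae_eq t u] with y hy
  rw [hy, chirp_apply, schrodingerSymbol_eq_exp_toC]
  ring

/-- Galilean covariance: on the Fourier side the propagator is a chirp, and conjugating a
Heisenberg–Weyl operator by a chirp shears phase space. -/
theorem weylNorm_fourier_freeSchrodinger (t : ℝ) (u : L2Rn n) (c b : Rn n) :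
    weylNorm (𝓕 (freeSchrodinger t u)) c b
      = weylNorm (𝓕 u) c (b + (8 * Real.pi ^ 2 * t) • c) := by
  set s : ℝ := -(2 * Real.pi) ^ 2 * t with hs
  have hb : toC (b + (8 * Real.pi ^ 2 * t) • c) + (2 * Complex.I * s) • -Complex.I • toC c
      = toC b := by
    ext i
    simp only [hs, toC_add, toC_smul, Pi.add_apply, Pi.smul_apply, smul_eq_mul]
    push_cast
    linear_combination (8 * Real.pi ^ 2 * t * toC c i : ℂ) * Complex.I_mul_I
  refine (surjective_chirp s).iSup_congr _ fun G => ?_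
  simp only [← ofReal_norm]
  rw [weyl_chirp, hb, norm_toL2_chirp, inner_star_fourier_freeSchrodinger]

theorem expNorm_freeSchrodinger (t : ℝ) (u : L2Rn n) (a : Rn n) :
    expNorm a (freeSchrodinger t u)
      = weylNorm (𝓕 u) ((2 * Real.pi)⁻¹ • a) ((4 * Real.pi * t) • a) := by
  have ha : (2 * Real.pi) • (2 * Real.pi)⁻¹ • a = a := smul_inv_smul₀ (by positivity) a
  rw [← weylNorm_zero_left, ← ha, ← weylNorm_fourier, weylNorm_fourier_freeSchrodinger, zero_add,
    ha, smul_smul]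
  congr 2
  field_simp
  ring

theorem weylNorm_convexComb_le (φ : L2Rn n) {c c₀ c₁ b b₀ b₁ : Rn n} {θ : ℝ}
    (hθ : θ ∈ Set.Icc 0 1) (hc : c = θ • c₀ + (1 - θ) • c₁) (hb : b = θ • b₀ + (1 - θ) • b₁) :
    weylNorm φ c b ≤ weylNorm φ c₀ b₀ ^ θ * weylNorm φ c₁ b₁ ^ (1 - θ) := by
  have h := weylNorm_line_le φ c₀ (c₁ - c₀) b₀ (b₁ - b₀) (x := 1 - θ)
    ⟨sub_nonneg.2 hθ.2, sub_le_self _ hθ.1⟩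
  have comb (x y : Rn n) : x + (1 - θ) • (y - x) = θ • x + (1 - θ) • y := by module
  rwa [comb, comb, ← hc, ← hb, add_sub_cancel, add_sub_cancel, sub_sub_cancel] at h

theorem expNorm_freeSchrodinger_le (u : L2Rn n) {a a₀ a₁ : Rn n} {t t₀ t₁ θ : ℝ}
    (hθ : θ ∈ Set.Icc 0 1) (ha : a = θ • a₀ + (1 - θ) • a₁)
    (hta : t • a = θ • t₀ • a₀ + (1 - θ) • t₁ • a₁) :
    expNorm a (freeSchrodinger t u)
      ≤ expNorm a₀ (freeSchrodinger t₀ u) ^ θ * expNorm a₁ (freeSchrodinger t₁ u) ^ (1 - θ) := by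
  simp only [expNorm_freeSchrodinger]
  refine weylNorm_convexComb_le _ hθ ?_ ?_
  · rw [ha]
    module
  · rw [mul_smul, hta]
    module

end Schrodinger

section Scaling

theorem eLpNorm_comp_smul {E F : Type*} [NormedAddCommGroup E] [NormedSpace ℝ E]
    [FiniteDimensional ℝ E] [MeasurableSpace E] [BorelSpace E] [NormedAddCommGroup F]
    (μ : Measure E) [μ.IsAddHaarMeasure] {p : ℝ≥0∞} (hp : p ≠ ⊤) {c : ℝ} (hc : c ≠ 0) (f : E → F) :
    eLpNorm (fun x => f (c • x)) p μ
      = ENNReal.ofReal |(c ^ Module.finrank ℝ E)⁻¹| ^ (1 / p).toReal * eLpNorm f p μ := by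
  have hemb : MeasurableEmbedding fun x : E => c • x :=
    (Homeomorph.smulOfNeZero c hc).measurableEmbedding
  rw [← smul_eq_mul, ← eLpNorm_smul_measure_of_ne_top hp, ← Measure.map_addHaar_smul μ hc,
    hemb.eLpNorm_map_measure]
  rfl

variable {n : ℕ}

theorem aestronglyMeasurable_unitaryFourier (u : L2Rn n) :
    AEStronglyMeasurable (unitaryFourier u) volume :=
  ((Lp.aestronglyMeasurable (𝓕 u : L2Rn n)).comp_quasiMeasurePreserving
    (Measure.quasiMeasurePreserving_smul volume (by positivity))).const_mul _

theorem expNorm_unitaryFourier (a : Rn n) (u : L2Rn n) :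
    expNorm a (unitaryFourier u) = expNorm ((2 * Real.pi) • a) (𝓕 u : L2Rn n) := by
  have hpos : 0 < 2 * Real.pi := Real.two_pi_pos
  have hscale := eLpNorm_comp_smul (volume : Measure (Rn n)) (p := 2) ENNReal.ofNat_ne_top
    (inv_ne_zero hpos.ne')
    fun ζ => (Real.exp ⟪(2 * Real.pi) • a, ζ⟫_ℝ : ℂ) * (𝓕 u : L2Rn n) ζ
  simp only [real_inner_smul_left, real_inner_smul_right, inv_mul_cancel_left₀ hpos.ne',
    finrank_euclideanSpace_fin] at hscale
  have hfun : (fun ξ => (Real.exp ⟪a, ξ⟫_ℝ : ℂ) * unitaryFourier u ξ)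
      = (((2 * Real.pi) ^ (-((n : ℝ) / 2)) : ℝ) : ℂ) • fun ξ =>
          (Real.exp ⟪a, ξ⟫_ℝ : ℂ) * (𝓕 u : L2Rn n) ((2 * Real.pi)⁻¹ • ξ) :=
    funext fun ξ => mul_left_comm _ _ _
  have hconst : ‖(((2 * Real.pi) ^ (-((n : ℝ) / 2)) : ℝ) : ℂ)‖ₑ *
      ENNReal.ofReal |(((2 * Real.pi)⁻¹) ^ n)⁻¹| ^ (1 / 2 : ℝ≥0∞).toReal = 1 := by
    rw [← ofReal_norm, Complex.norm_real, Real.norm_of_nonneg (by positivity), inv_pow, inv_inv,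
      abs_of_pos (by positivity), ENNReal.ofReal_rpow_of_pos (by positivity),
      ← ENNReal.ofReal_mul (by positivity), ← Real.rpow_natCast, ← Real.rpow_mul hpos.le,
      ← Real.rpow_add hpos]
    simp [div_eq_mul_inv]
  rw [expNorm, hfun, eLpNorm_const_smul, hscale, ← mul_assoc, hconst, one_mul, expNorm]
  simp only [real_inner_smul_left]

theorem expNorm_freeSchrodinger_le_unitaryFourier (u : L2Rn n) {a a₀ a₁ : Rn n} {t t₀ θ : ℝ}
    (hθ : θ ∈ Set.Icc 0 1) (ha : a = θ • a₀)
    (hta : t • a = θ • t₀ • a₀ + ((1 - θ) / 2) • a₁) :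
    expNorm a (freeSchrodinger t u)
      ≤ expNorm a₀ (freeSchrodinger t₀ u) ^ θ * expNorm a₁ (unitaryFourier u) ^ (1 - θ) := by
  rw [expNorm_freeSchrodinger, expNorm_freeSchrodinger, expNorm_unitaryFourier,
    ← weylNorm_zero_left (𝓕 u)]
  refine weylNorm_convexComb_le _ hθ ?_ ?_
  · rw [ha]
    module
  · rw [mul_smul, hta]
    module

end Scaling

section GaussianAverage

open ProbabilityTheory

theorem map_inner_stdGaussian {E : Type*} [NormedAddCommGroup E] [InnerProductSpace ℝ E]
    [FiniteDimensional ℝ E] [MeasurableSpace E] [BorelSpace E] (z : E) :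
    (stdGaussian E).map (fun l => ⟪z, l⟫_ℝ) = gaussianReal 0 (‖z‖₊ ^ 2) := by
  have h := IsGaussian.map_eq_gaussianReal (μ := stdGaussian E) (innerSL ℝ z)
  rw [integral_strongDual_stdGaussian, variance_dual_stdGaussian, innerSL_apply_norm] at h
  rwa [Real.toNNReal_pow (norm_nonneg z), norm_toNNReal] at h

theorem lintegral_exp_inner_stdGaussian {E : Type*} [NormedAddCommGroup E] [InnerProductSpace ℝ E]
    [FiniteDimensional ℝ E] [MeasurableSpace E] [BorelSpace E] (z : E) :
    ∫⁻ l, ENNReal.ofReal (Real.exp ⟪z, l⟫_ℝ) ∂stdGaussian E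
      = ENNReal.ofReal (Real.exp (‖z‖ ^ 2 / 2)) := by
  have hmap := map_inner_stdGaussian z
  have hint : Integrable (fun l => Real.exp ⟪z, l⟫_ℝ) (stdGaussian E) := by
    have h := integrable_exp_mul_gaussianReal (μ := 0) (v := ‖z‖₊ ^ 2) 1
    rw [← hmap, integrable_map_measure (by fun_prop) (by fun_prop)] at h
    simpa [Function.comp_def] using h
  rw [← ofReal_integral_eq_lintegral_ofReal hint (.of_forall fun l => (Real.exp_pos _).le)]
  simpa [mgf] using congrArg ENNReal.ofReal (mgf_gaussianReal hmap 1)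

variable {n : ℕ}

theorem interactionNorm_sq (w : Rn n → ℝ) (f g : Rn n → ℂ) :
    interactionNorm w f g ^ 2 = ∫⁻ p : Rn n × Rn n,
      ENNReal.ofReal (Real.exp (2 * w (p.1 - p.2))) * (‖f p.1‖ₑ ^ 2 * ‖g p.2‖ₑ ^ 2)
        ∂((volume : Measure (Rn n)).prod volume) := by
  have hsq := eLpNorm_nnreal_pow_eq_lintegral (μ := (volume : Measure (Rn n)).prod volume) (p := 2)
    (f := fun p => (Real.exp (w (p.1 - p.2)) : ℂ) * (f p.1 * g p.2)) two_ne_zero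
  simp only [NNReal.coe_ofNat, ENNReal.coe_ofNat, ENNReal.rpow_ofNat] at hsq
  rw [interactionNorm, hsq]
  refine lintegral_congr fun p => ?_
  rw [enorm_mul, enorm_mul, mul_pow, mul_pow, ← ofReal_norm, Complex.norm_real,
    Real.norm_of_nonneg (Real.exp_pos _).le, ← ENNReal.ofReal_pow (Real.exp_pos _).le,
    ← Real.exp_nat_mul, Nat.cast_ofNat]

theorem aemeasurable_linear_interaction {f g : Rn n → ℂ} (hf : AEStronglyMeasurable f volume)
    (hg : AEStronglyMeasurable g volume) (c : ℝ) :
    AEMeasurable (fun q : Rn n × (Rn n × Rn n) =>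
      ENNReal.ofReal (Real.exp (2 * (⟪q.1, q.2.1 - q.2.2⟫_ℝ / c))) *
        (‖f q.2.1‖ₑ ^ 2 * ‖g q.2.2‖ₑ ^ 2))
      ((stdGaussian (Rn n)).prod ((volume : Measure (Rn n)).prod volume)) := by
  have hweight : Measurable fun q : Rn n × (Rn n × Rn n) =>
      ENNReal.ofReal (Real.exp (2 * (⟪q.1, q.2.1 - q.2.2⟫_ℝ / c))) := by fun_prop
  have hmass : AEMeasurable (fun p : Rn n × Rn n => ‖f p.1‖ₑ ^ 2 * ‖g p.2‖ₑ ^ 2)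
      ((volume : Measure (Rn n)).prod volume) :=
    (hf.comp_fst.enorm.pow_const 2).mul (hg.comp_snd.enorm.pow_const 2)
  exact hweight.aemeasurable.mul hmass.comp_snd

theorem aemeasurable_interactionNorm_linear_sq {f g : Rn n → ℂ}
    (hf : AEStronglyMeasurable f volume) (hg : AEStronglyMeasurable g volume) (c : ℝ) :
    AEMeasurable (fun l => interactionNorm (fun z => ⟪l, z⟫_ℝ / c) f g ^ 2)
      (stdGaussian (Rn n)) := by
  simp only [interactionNorm_sq]
  exact (aemeasurable_linear_interaction hf hg c).lintegral_prod_right'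

theorem lintegral_interactionNorm_linear_sq {f g : Rn n → ℂ}
    (hf : AEStronglyMeasurable f volume) (hg : AEStronglyMeasurable g volume) (c : ℝ) :
    ∫⁻ l, interactionNorm (fun z => ⟪l, z⟫_ℝ / c) f g ^ 2 ∂stdGaussian (Rn n)
      = interactionNorm (fun z => ‖z‖ ^ 2 / c ^ 2) f g ^ 2 := by
  have hmean (z : Rn n) :
      ∫⁻ l, ENNReal.ofReal (Real.exp (2 * (⟪l, z⟫_ℝ / c))) ∂stdGaussian (Rn n)
        = ENNReal.ofReal (Real.exp (2 * (‖z‖ ^ 2 / c ^ 2))) := by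
    convert lintegral_exp_inner_stdGaussian ((2 / c) • z) using 5 with l
    · rw [real_inner_smul_left, real_inner_comm]
      ring
    · rw [norm_smul, mul_pow, Real.norm_eq_abs, sq_abs]
      ring
  simp only [interactionNorm_sq]
  rw [lintegral_lintegral_swap (aemeasurable_linear_interaction hf hg c)]
  refine lintegral_congr fun p => ?_
  rw [lintegral_mul_const _ (by fun_prop), hmean]

theorem interactionNorm_quadratic_le {f g f₀ g₀ f₁ g₁ : Rn n → ℂ}
    (hf : AEStronglyMeasurable f volume) (hg : AEStronglyMeasurable g volume)
    (hf₀ : AEStronglyMeasurable f₀ volume) (hg₀ : AEStronglyMeasurable g₀ volume)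
    (hf₁ : AEStronglyMeasurable f₁ volume) (hg₁ : AEStronglyMeasurable g₁ volume)
    {c c₀ c₁ θ : ℝ} (hθ : θ ∈ Set.Icc 0 1)
    (h : ∀ l : Rn n, interactionNorm (fun z => ⟪l, z⟫_ℝ / c) f g
      ≤ interactionNorm (fun z => ⟪l, z⟫_ℝ / c₀) f₀ g₀ ^ θ *
        interactionNorm (fun z => ⟪l, z⟫_ℝ / c₁) f₁ g₁ ^ (1 - θ)) :
    interactionNorm (fun z => ‖z‖ ^ 2 / c ^ 2) f g
      ≤ interactionNorm (fun z => ‖z‖ ^ 2 / c₀ ^ 2) f₀ g₀ ^ θ *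
        interactionNorm (fun z => ‖z‖ ^ 2 / c₁ ^ 2) f₁ g₁ ^ (1 - θ) := by
  have sq_interp (A B : ℝ≥0∞) : (A ^ θ * B ^ (1 - θ)) ^ 2 = (A ^ 2) ^ θ * (B ^ 2) ^ (1 - θ) := by
    rw [mul_pow, ← ENNReal.rpow_mul_natCast, ← ENNReal.rpow_mul_natCast, mul_comm θ,
      mul_comm (1 - θ), ENNReal.rpow_natCast_mul, ENNReal.rpow_natCast_mul]
  rw [← (ENNReal.pow_right_strictMono two_ne_zero).le_iff_le, sq_interp,
    ← lintegral_interactionNorm_linear_sq hf hg, ← lintegral_interactionNorm_linear_sq hf₀ hg₀,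
    ← lintegral_interactionNorm_linear_sq hf₁ hg₁]
  refine (lintegral_mono fun l => ?_).trans (ENNReal.lintegral_mul_norm_pow_le
    (aemeasurable_interactionNorm_linear_sq hf₀ hg₀ c₀)
    (aemeasurable_interactionNorm_linear_sq hf₁ hg₁ c₁) hθ.1 (sub_nonneg.2 hθ.2)
    (add_sub_cancel _ _))
  rw [← sq_interp]
  gcongr
  exact h l

end GaussianAverage

section TwoParticles

variable {n : ℕ}

theorem eLpNorm_prod_mul {X Y : Type*} [MeasurableSpace X] [MeasurableSpace Y] {μ : Measure X}
    {ν : Measure Y} [SFinite ν] {𝕜 : Type*} [NormedDivisionRing 𝕜] {p : ℝ≥0∞} (hp₀ : p ≠ 0)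
    (hp : p ≠ ⊤) {f : X → 𝕜} {g : Y → 𝕜} (hf : AEStronglyMeasurable f μ)
    (hg : AEStronglyMeasurable g ν) :
    eLpNorm (fun q : X × Y => f q.1 * g q.2) p (μ.prod ν) = eLpNorm f p μ * eLpNorm g p ν := by
  simp only [eLpNorm_eq_lintegral_rpow_enorm_toReal hp₀ hp, enorm_mul,
    ENNReal.mul_rpow_of_nonneg _ _ ENNReal.toReal_nonneg]
  rw [lintegral_prod_mul (hf.enorm.pow_const _) (hg.enorm.pow_const _),
    ENNReal.mul_rpow_of_nonneg _ _ (by positivity)]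

theorem interactionNorm_inner {f g : Rn n → ℂ} (hf : AEStronglyMeasurable f volume)
    (hg : AEStronglyMeasurable g volume) (a : Rn n) :
    interactionNorm (fun z => ⟪a, z⟫_ℝ) f g = expNorm a f * expNorm (-a) g := by
  rw [expNorm, expNorm, ← eLpNorm_prod_mul two_ne_zero ENNReal.ofNat_ne_top
    (aestronglyMeasurable_exp_inner_mul hf a) (aestronglyMeasurable_exp_inner_mul hg (-a)),
    interactionNorm]
  refine congrArg (eLpNorm · 2 _) (funext fun p => ?_)
  rw [inner_sub_right, sub_eq_add_neg, ← inner_neg_left, Real.exp_add, Complex.ofReal_mul,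
    mul_mul_mul_comm]

theorem interactionNorm_inner_le {f g f₀ g₀ f₁ g₁ : Rn n → ℂ}
    (hf : AEStronglyMeasurable f volume) (hg : AEStronglyMeasurable g volume)
    (hf₀ : AEStronglyMeasurable f₀ volume) (hg₀ : AEStronglyMeasurable g₀ volume)
    (hf₁ : AEStronglyMeasurable f₁ volume) (hg₁ : AEStronglyMeasurable g₁ volume)
    {a a₀ a₁ : Rn n} {θ : ℝ} (hθ : θ ∈ Set.Icc 0 1)
    (hf_le : expNorm a f ≤ expNorm a₀ f₀ ^ θ * expNorm a₁ f₁ ^ (1 - θ))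
    (hg_le : expNorm (-a) g ≤ expNorm (-a₀) g₀ ^ θ * expNorm (-a₁) g₁ ^ (1 - θ)) :
    interactionNorm (fun z => ⟪a, z⟫_ℝ) f g
      ≤ interactionNorm (fun z => ⟪a₀, z⟫_ℝ) f₀ g₀ ^ θ *
        interactionNorm (fun z => ⟪a₁, z⟫_ℝ) f₁ g₁ ^ (1 - θ) := by
  rw [interactionNorm_inner hf hg, interactionNorm_inner hf₀ hg₀, interactionNorm_inner hf₁ hg₁,
    ENNReal.mul_rpow_of_nonneg _ _ hθ.1, ENNReal.mul_rpow_of_nonneg _ _ (sub_nonneg.2 hθ.2),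
    mul_mul_mul_comm]
  exact mul_le_mul' hf_le hg_le

theorem interactionNorm_freeSchrodinger_le (u v : L2Rn n) (l : Rn n) {c c₀ c₁ t t₀ t₁ θ : ℝ}
    (hθ : θ ∈ Set.Icc 0 1) (hc : c⁻¹ = θ * c₀⁻¹ + (1 - θ) * c₁⁻¹)
    (htc : t / c = θ * (t₀ / c₀) + (1 - θ) * (t₁ / c₁)) :
    interactionNorm (fun z => ⟪l, z⟫_ℝ / c) (freeSchrodinger t u) (freeSchrodinger t v)
      ≤ interactionNorm (fun z => ⟪l, z⟫_ℝ / c₀) (freeSchrodinger t₀ u) (freeSchrodinger t₀ v) ^ θ *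
        interactionNorm (fun z => ⟪l, z⟫_ℝ / c₁) (freeSchrodinger t₁ u) (freeSchrodinger t₁ v)
          ^ (1 - θ) := by
  have hle (w : L2Rn n) (m : Rn n) := expNorm_freeSchrodinger_le w (a := c⁻¹ • m) (a₀ := c₀⁻¹ • m)
    (a₁ := c₁⁻¹ • m) (t := t) (t₀ := t₀) (t₁ := t₁) hθ (by rw [hc]; module)
    (by rw [smul_smul, ← div_eq_mul_inv, htc]; module)
  simp only [div_eq_inv_mul, ← real_inner_smul_left]
  exact interactionNorm_inner_le (Lp.aestronglyMeasurable _) (Lp.aestronglyMeasurable _)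
    (Lp.aestronglyMeasurable _) (Lp.aestronglyMeasurable _) (Lp.aestronglyMeasurable _)
    (Lp.aestronglyMeasurable _) hθ (hle u l) (by simpa only [smul_neg] using hle v (-l))

theorem interactionNorm_freeSchrodinger_le_unitaryFourier (u v : L2Rn n) (l : Rn n)
    {c c₀ c₁ t t₀ θ : ℝ} (hθ : θ ∈ Set.Icc 0 1) (hc : c⁻¹ = θ * c₀⁻¹)
    (htc : t / c = θ * (t₀ / c₀) + (1 - θ) / (2 * c₁)) :
    interactionNorm (fun z => ⟪l, z⟫_ℝ / c) (freeSchrodinger t u) (freeSchrodinger t v)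
      ≤ interactionNorm (fun z => ⟪l, z⟫_ℝ / c₀) (freeSchrodinger t₀ u) (freeSchrodinger t₀ v) ^ θ *
        interactionNorm (fun z => ⟪l, z⟫_ℝ / c₁) (unitaryFourier u) (unitaryFourier v)
          ^ (1 - θ) := by
  have hle (w : L2Rn n) (m : Rn n) := expNorm_freeSchrodinger_le_unitaryFourier w (a := c⁻¹ • m)
    (a₀ := c₀⁻¹ • m) (a₁ := c₁⁻¹ • m) (t := t) (t₀ := t₀) hθ (by rw [hc]; module)
    (by rw [smul_smul, ← div_eq_mul_inv, htc]; module)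
  simp only [div_eq_inv_mul, ← real_inner_smul_left]
  exact interactionNorm_inner_le (Lp.aestronglyMeasurable _) (Lp.aestronglyMeasurable _)
    (Lp.aestronglyMeasurable _) (Lp.aestronglyMeasurable _) (aestronglyMeasurable_unitaryFourier _)
    (aestronglyMeasurable_unitaryFourier _) hθ (hle u l)
    (by simpa only [smul_neg] using hle v (-l))

end TwoParticles

section Exponents

variable {α β T t : ℝ}

theorem thetaExp_mem_Icc (hα : 0 < α) (hβ : 0 < β) (hT : 0 < T) (ht : 0 ≤ t) (htT : t ≤ T) :
    thetaExp α β T t ∈ Set.Icc 0 1 := by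
  have := sub_nonneg.2 htT
  refine ⟨by unfold thetaExp; positivity, ?_⟩
  rw [thetaExp, div_le_one (by positivity)]
  nlinarith [mul_nonneg (mul_nonneg hα.le ht) hT.le, mul_nonneg hβ.le ht]

theorem inv_eq_thetaExp (hα : 0 < α) (hβ : 0 < β) (hT : 0 < T) (ht : 0 ≤ t) :
    (α * t + β)⁻¹ = thetaExp α β T t * β⁻¹ + (1 - thetaExp α β T t) * (α * T + β)⁻¹ := by
  have : 0 < α * t + β := by positivity
  unfold thetaExp
  field_simp
  ring

theorem div_eq_thetaExp (hα : 0 < α) (hβ : 0 < β) (hT : 0 < T) (ht : 0 ≤ t) :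
    t / (α * t + β) = (1 - thetaExp α β T t) * (T / (α * T + β)) := by
  have : 0 < α * t + β := by positivity
  unfold thetaExp
  field_simp
  ring

theorem muExp_mem_Icc (hα : 0 < α) (hβ : 0 < β) (ht : 0 ≤ t) : muExp α β t ∈ Set.Icc 0 1 := by
  refine ⟨by unfold muExp; positivity, ?_⟩
  rw [muExp, div_le_one (by positivity)]
  exact le_add_of_nonneg_left (mul_nonneg hα.le ht)

theorem inv_eq_muExp (hβ : β ≠ 0) : (α * t + β)⁻¹ = muExp α β t * β⁻¹ := by
  unfold muExp
  field_simp

theorem div_eq_muExp (hα : 0 < α) (hβ : 0 < β) (ht : 0 ≤ t) :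
    t / (α * t + β) = (1 - muExp α β t) / α := by
  have : 0 < α * t + β := by positivity
  unfold muExp
  field_simp
  ring

end Exponents

theorem corollary3p4 (n : ℕ) (α β : ℝ) (hα : 0 < α) (hβ : 0 < β) (u₀ v₀ : L2Rn n) :
    (∀ (l : Rn n) (T t : ℝ), 0 < T → 0 ≤ t → t ≤ T →
      interactionNorm (fun z => inner ℝ l z / (α * t + β))
          (freeSchrodinger t u₀) (freeSchrodinger t v₀)
        ≤ interactionNorm (fun z => inner ℝ l z / β) u₀ v₀ ^ thetaExp α β T t
          * interactionNorm (fun z => inner ℝ l z / (α * T + β))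
              (freeSchrodinger T u₀) (freeSchrodinger T v₀) ^ (1 - thetaExp α β T t)) ∧
    (∀ T t : ℝ, 0 < T → 0 ≤ t → t ≤ T →
      interactionNorm (fun z => ‖z‖ ^ 2 / (α * t + β) ^ 2)
          (freeSchrodinger t u₀) (freeSchrodinger t v₀)
        ≤ interactionNorm (fun z => ‖z‖ ^ 2 / β ^ 2) u₀ v₀ ^ thetaExp α β T t
          * interactionNorm (fun z => ‖z‖ ^ 2 / (α * T + β) ^ 2)
              (freeSchrodinger T u₀) (freeSchrodinger T v₀) ^ (1 - thetaExp α β T t)) ∧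
    (∀ (l : Rn n) (t : ℝ), 0 ≤ t →
      interactionNorm (fun z => inner ℝ l z / (α * t + β))
          (freeSchrodinger t u₀) (freeSchrodinger t v₀)
        ≤ interactionNorm (fun z => inner ℝ l z / β) u₀ v₀ ^ muExp α β t
          * interactionNorm (fun ζ => 2 * inner ℝ l ζ / α)
              (unitaryFourier u₀) (unitaryFourier v₀) ^ (1 - muExp α β t)) ∧
    (∀ t : ℝ, 0 ≤ t →
      interactionNorm (fun z => ‖z‖ ^ 2 / (α * t + β) ^ 2)
          (freeSchrodinger t u₀) (freeSchrodinger t v₀)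
        ≤ interactionNorm (fun z => ‖z‖ ^ 2 / β ^ 2) u₀ v₀ ^ muExp α β t
          * interactionNorm (fun ζ => 4 * ‖ζ‖ ^ 2 / α ^ 2)
              (unitaryFourier u₀) (unitaryFourier v₀) ^ (1 - muExp α β t)) := by
  have hm (w : L2Rn n) : AEStronglyMeasurable w volume := Lp.aestronglyMeasurable w
  have hF (w : L2Rn n) := aestronglyMeasurable_unitaryFourier w
  have linear (l : Rn n) (T t : ℝ) (hT : 0 < T) (ht : 0 ≤ t) (htT : t ≤ T) :=
    interactionNorm_freeSchrodinger_le (t₀ := 0) u₀ v₀ l (thetaExp_mem_Icc hα hβ hT ht htT)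
      (inv_eq_thetaExp hα hβ hT ht) (by simpa using div_eq_thetaExp hα hβ hT ht)
  have linear' (l : Rn n) (t : ℝ) (ht : 0 ≤ t) :=
    interactionNorm_freeSchrodinger_le_unitaryFourier (t₀ := 0) (c₁ := α / 2) u₀ v₀ l
      (muExp_mem_Icc hα hβ ht) (inv_eq_muExp hβ.ne')
      (by simpa [mul_div_cancel₀] using div_eq_muExp hα hβ ht)
  simp only [freeSchrodinger_zero] at linear linear'
  have hdiv (l z : Rn n) : 2 * ⟪l, z⟫_ℝ / α = ⟪l, z⟫_ℝ / (α / 2) := by ring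
  have hdiv_sq (z : Rn n) : 4 * ‖z‖ ^ 2 / α ^ 2 = ‖z‖ ^ 2 / (α / 2) ^ 2 := by ring
  simp only [hdiv, hdiv_sq]
  exact ⟨linear,
    fun T t hT ht htT => interactionNorm_quadratic_le (hm _) (hm _) (hm _) (hm _) (hm _) (hm _)
      (thetaExp_mem_Icc hα hβ hT ht htT) fun l => linear l T t hT ht htT,
    linear',
    fun t ht => interactionNorm_quadratic_le (hm _) (hm _) (hm _) (hm _) (hF _) (hF _)
      (muExp_mem_Icc hα hβ ht) fun l => linear' l t ht⟩
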